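/- Let $V$ be a finite set with at least two elements and let $\alpha=(\alpha_{ij})$ be symmetric nonnegative weights on the pairs of distinct elements of $V$. Let $\mathcal L^{RW}(\alpha)$ be the $V\times V$ matrix with off-diagonal entries $-\alpha_{ij}$ and diagonal entries $\sum_{k\ne i}\alpha_{ik}$ (the Laplacian of the random walk), and let $\mathcal L^{I}(\alpha)$ be the matrix indexed by the permutations of $V$ with diagonal entries $\sum_{\{i,j\}}\alpha_{ij}$ (sum over unordered pairs), entries $-\alpha_{ij}$ at $(\sigma,(ij)\sigma)$, and all other entries $0$ (the Laplacian of the interchange process). We say that Aldous' conjecture holds for $(V,\alpha)$ if the second smallest eigenvalues, counted with multiplicity, of $\mathcal L^{I}(\alpha)$ and of $\mathcal L^{RW}(\alpha)$ are equal; if $\alpha$ is connected, this says that the two processes have the same spectral gap. Call a finite loopless multigraph reducible to an edge if it can be transformed into a single edge joining two vertices (with no other vertices) by finitely many of the following operations: - degree-one reduction: delete a vertex of degree one and its incident edge; - series reduction: delete a vertex $k$ of degree two and its two incident edges $(i,k)$, $(j,k)$, where $i\neq j$, and add a new edge $(i,j)$; - parallel reduction: delete one of a pair of parallel edges; - Y–$\Delta$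 transformation: delete a vertex $k$ of degree three and its three incident edges $(i,k)$, $(j,k)$, $(\ell,k)$, where $i,j,\ell$ are distinct, and add the edges $(i,j)$, $(j,\ell)$, $(i,\ell)$. Then the following hold. 1. If $G$ is a finite loopless multigraph with vertex set $V$ that is reducible to an edge, then Aldous' conjecture holds for $(V,\alpha)$ for all symmetric nonnegative weights $\alpha$ such that $\alpha_{ij}=0$ whenever $i$ and $j$ are not adjacent in $G$. 2. For every $n\ge 3$, the wheel graph $W_n$ with $n$ vertices (a hub joined to all vertices of a cycle on $n-1$ vertices; $W_3=K_3$) is reducible to an edge. Hence Aldous' conjecture holds for $W_n$ with arbitrary nonnegative weights on its edges. 3. For every $n\ge 3$, the cycle $C_n$ with $n$ vertices is isomorphic to a subgraph of $W_n$ and is reducible to an edge, and Aldous' conjecture holds for $C_n$ with arbitrary nonnegative weights on its edges. -/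

import Mathlib

universe u

/-- A finite loopless undirected multigraph with vertices in `V`: a finite vertex set together with
a finite multiset of unordered pairs of distinct vertices (multiplicities are parallel edges). -/
structure LooplessMultigraph (V : Type u) where
  verts : Finset V
  edges : Multiset (Sym2 V)
  mem_verts : ∀ e ∈ edges, ∀ v ∈ e, v ∈ verts
  loopless : ∀ e ∈ edges, ¬ e.IsDiag

namespace LooplessMultigraph

variable {V : Type u}

/-- The multigraph given by a simple graph on a finite vertex type. -/
noncomputable def ofSimple [Fintype V] (G : SimpleGraph V) : LooplessMultigraph V where
  verts := Finset.univ
  edges := (Set.toFinite G.edgeSet).toFinset.val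
  mem_verts := fun _ _ v _ => Finset.mem_univ v
  loopless := fun e he => by
    have h : e ∈ G.edgeSet := by simpa using he
    exact G.not_isDiag_of_mem_edgeSet h

variable [DecidableEq V]

/-- The edges incident to the vertex `k`, with multiplicity. -/
def incident (G : LooplessMultigraph V) (k : V) : Multiset (Sym2 V) :=
  G.edges.filter (fun e => k ∈ e)

/-- The edges not incident to the vertex `k`, with multiplicity. -/
def remaining (G : LooplessMultigraph V) (k : V) : Multiset (Sym2 V) :=
  G.edges.filter (fun e => k ∉ e)

/-- `Step G H`: the multigraph `H` arises from `G` by one permissible reduction. -/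
inductive Step : LooplessMultigraph V → LooplessMultigraph V → Prop
  /-- Delete a vertex `k` of degree one and its incident edge. -/
  | degreeOne (G H : LooplessMultigraph V) (i k : V)
      (hk : G.incident k = {s(i, k)})
      (hverts : H.verts = G.verts.erase k)
      (hedges : H.edges = G.remaining k) : Step G H
  /-- Delete a vertex `k` of degree two and its two incident edges `ik`, `jk`; add an edge `ij`. -/
  | series (G H : LooplessMultigraph V) (i j k : V) (hij : i ≠ j)
      (hk : G.incident k = {s(i, k), s(j, k)})
      (hverts : H.verts = G.verts.erase k)
      (hedges : H.edges = {s(i, j)} + G.remaining k) : Step G H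
  /-- Delete one of a pair of parallel edges. -/
  | parallel (G H : LooplessMultigraph V) (e : Sym2 V)
      (he : 2 ≤ G.edges.count e)
      (hverts : H.verts = G.verts)
      (hedges : H.edges = G.edges.erase e) : Step G H
  /-- Delete a vertex `k` and its three incident edges `ik`, `jk`, `lk`; add the triangle `ijl`. -/
  | starTriangle (G H : LooplessMultigraph V) (i j l k : V) (hij : i ≠ j) (hil : i ≠ l) (hjl : j ≠ l)
      (hk : G.incident k = {s(i, k), s(j, k), s(l, k)})
      (hverts : H.verts = G.verts.erase k)
      (hedges : H.edges = {s(i, j), s(j, l), s(i, l)} + G.remaining k) : Step G H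

/-- `G` is a single edge joining two vertices (and has no other vertices or edges). -/
def IsEdge (G : LooplessMultigraph V) : Prop :=
  ∃ u v : V, u ≠ v ∧ G.verts = {u, v} ∧ G.edges = {s(u, v)}

/-- `G` can be transformed into a single edge by finitely many permissible reductions. -/
def ReducibleToEdge (G : LooplessMultigraph V) : Prop :=
  ∃ H : LooplessMultigraph V, Relation.ReflTransGen Step G H ∧ H.IsEdge

end LooplessMultigraph

/-- The wheel graph with `n` vertices: a hub `none` joined to every vertex of a rim, which is the
cycle graph on `n - 1` vertices (for `n = 3` the rim is one edge and the wheel is a triangle). -/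
def wheelGraph (n : ℕ) : SimpleGraph (Option (Fin (n - 1))) where
  Adj
    | none, none => False
    | none, some _ => True
    | some _, none => True
    | some i, some j => (SimpleGraph.cycleGraph (n - 1)).Adj i j
  symm := ⟨by
    rintro (_ | i) (_ | j) h
    · exact h
    · trivial
    · trivial
    · exact SimpleGraph.Adj.symm h⟩
  loopless := ⟨by
    rintro (_ | i) h
    · exact h
    · exact (SimpleGraph.cycleGraph (n - 1)).irrefl h⟩

/-- Symmetric nonnegative weights `α i j` (interchange rates) on pairs of vertices. -/
structure EdgeWeights (V : Type u) where
  weight : V → V → ℝ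
  symm : ∀ i j, weight i j = weight j i
  nonneg : ∀ i j, 0 ≤ weight i j

namespace EdgeWeights

variable {V : Type u}

/-- The weights vanish off the edges of the multigraph `G` (they may vanish on edges as well). -/
def SupportedOn (α : EdgeWeights V) (G : LooplessMultigraph V) : Prop :=
  ∀ i j, α.weight i j ≠ 0 → s(i, j) ∈ G.edges

variable [Fintype V] [DecidableEq V]

/-- The Laplacian of the random walk: the negative of the intensity matrix of the Markov chain
on `V` that jumps from `i` to `j ≠ i` at rate `α i j`. -/
noncomputable def randomWalkLaplacian (α : EdgeWeights V) : Matrix V V ℝ :=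
  Matrix.of fun i j =>
    if i = j then ∑ k ∈ Finset.univ.erase i, α.weight i k else -α.weight i j

/-- The Laplacian of the interchange process: the negative of the intensity matrix of the Markov
chain on the permutations of `V` that jumps from `σ` to `(i j) σ` at rate `α i j`, for every
unordered pair of distinct `i`, `j`. The sum runs over ordered pairs, hence the factor `1 / 2`;
terms with `i = j` vanish. -/
noncomputable def interchangeLaplacian (α : EdgeWeights V) :
    Matrix (Equiv.Perm V) (Equiv.Perm V) ℝ :=
  Matrix.of fun σ τ =>
    (1 / 2 : ℝ) * ∑ i, ∑ j, α.weight i j *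
      ((if τ = σ then 1 else 0) - (if τ = Equiv.swap i j * σ then 1 else 0))

theorem isHermitian_randomWalkLaplacian (α : EdgeWeights V) :
    α.randomWalkLaplacian.IsHermitian := by
  refine Matrix.IsHermitian.ext fun i j => ?_
  by_cases h : i = j
  · subst h; simp [randomWalkLaplacian]
  · simp [randomWalkLaplacian, h, Ne.symm h, α.symm i j]

theorem isHermitian_interchangeLaplacian (α : EdgeWeights V) :
    α.interchangeLaplacian.IsHermitian := by
  refine Matrix.IsHermitian.ext fun σ τ => ?_
  have h (i j : V) : σ = Equiv.swap i j * τ ↔ τ = Equiv.swap i j * σ := by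
    constructor <;> rintro rfl <;> simp
  simp [interchangeLaplacian, h, eq_comm (a := σ) (b := τ)]

end EdgeWeights

/-- The second smallest eigenvalue, counted with multiplicity, of a real symmetric matrix of size
at least two (`eigenvalues₀` lists the eigenvalues in decreasing order). Matrices of smaller size
get the value `0`. -/
noncomputable def secondSmallestEigenvalue {ι : Type u} [Fintype ι] [DecidableEq ι]
    (A : Matrix ι ι ℝ) (hA : A.IsHermitian) : ℝ :=
  if h : 2 ≤ Fintype.card ι then hA.eigenvalues₀ ⟨Fintype.card ι - 2, by omega⟩ else 0

namespace EdgeWeights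

variable {V : Type u} [Fintype V] [DecidableEq V]

/-- The spectral gap of the random walk. -/
noncomputable def randomWalkGap (α : EdgeWeights V) : ℝ :=
  secondSmallestEigenvalue α.randomWalkLaplacian α.isHermitian_randomWalkLaplacian

/-- The spectral gap of the interchange process. -/
noncomputable def interchangeGap (α : EdgeWeights V) : ℝ :=
  secondSmallestEigenvalue α.interchangeLaplacian α.isHermitian_interchangeLaplacian

/-- The assertion of Aldous' conjecture for the weighted graph with weights `α`. -/
def AldousHolds (α : EdgeWeights V) : Prop :=
  α.interchangeGap = α.randomWalkGap

end EdgeWeights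

/-!
The proof eliminates the vertices one at a time. A vertex `x` is removed from a weighted graph by
replacing its star with the weights `α x i * α x j / ∑ k, α x k` between its neighbours
(`EdgeWeights.eliminate`). If Aldous' conjecture holds for the smaller network, it holds for the
larger one, provided the *octopus inequality* holds at `x`: in the energy of the interchange
process, the star dominates the network that replaces it (`EdgeWeights.aldousHolds_of_eliminate`).

For the inequality between the gaps, the position of a single particle performs the random walk, so
that the interchange gap is at most the random walk gap. Conversely, let `f` be an eigenvector for
the interchange gap with sum zero. If the sums of `f` over the configurations with particle `p`
at `v` do not all vanish, they are an eigenvector of the random walk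
(`randomWalkGap_le_interchangeGap_of_marginal`). If they all vanish, then `f` has sum zero on each
coset of the permutations fixing `x`. The octopus inequality bounds the energy of `f` from below by
energies on the smaller network, hence by its gap (`interchangeGap_eliminate_mul_le`), and the
random walk gap does not decrease under elimination, because harmonic extension preserves the energy
(`randomWalkGap_le_eliminate`).

The octopus inequality is needed only for at most three neighbours, since each reduction deletes a
vertex of degree at most three. Let `c₁, c₂, c₃` be the weights of the legs (`a, b, c` below), and
`c₀ = -(c₁ + c₂ + c₃)`. The inequality says `∑ cᵢ² + T ≥ 0` with
`T = 2 ∑_{i < j} cᵢ cⱼ (i j)` in the group algebra of `S₄`. By Cauchy-Schwarz it is enough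
that `‖T f‖ ≤ (∑ cᵢ²) ‖f‖`. Because `∑ cᵢ = 0`, one finds
`(∑ cᵢ²)² ‖f‖² - ‖T f‖² = -c₀ c₁ c₂ c₃ ‖P (1 - ρ) f‖²`,
where `P` is the sum of the Klein four-group and `ρ` is a 3-cycle (`octopus_three`). For two legs
the norm bound is an equality (`octopus_two`).

Weights supported on a multigraph stay supported on the reduced multigraph
(`LooplessMultigraph.Step.aldousGraph`), and an edge is the base case. Cycles and wheels are reduced
by repeatedly deleting the last vertex of the rim, by a series reduction or by a Y-Δ transformation
followed by two parallel reductions.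
-/

/-! ### The second smallest eigenvalue -/

section Spectral

open Matrix

variable {ι : Type u} [Fintype ι] [DecidableEq ι] {A : Matrix ι ι ℝ}

/-- An orthonormal eigenbasis with two marked vectors, `p` for the second smallest and `q` for the
smallest eigenvalue, phrased through the dot product. -/
theorem exists_eigenbasis_secondSmallestEigenvalue (hA : A.IsHermitian)
    (hcard : 2 ≤ Fintype.card ι) :
    ∃ (v : ι → ι → ℝ) (ev : ι → ℝ) (p q : ι),
      (∀ i j, v i ⬝ᵥ v j = if i = j then 1 else 0) ∧
      (∀ f, f = ∑ i, (v i ⬝ᵥ f) • v i) ∧ (∀ i, A *ᵥ v i = ev i • v i) ∧ p ≠ q ∧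
      ev p = secondSmallestEigenvalue A hA ∧ ev q ≤ ev p ∧
      ∀ i, i ≠ q → secondSmallestEigenvalue A hA ≤ ev i := by
  set e : Fin (Fintype.card ι) ≃ ι := Fintype.equivOfCardEq (Fintype.card_fin _) with he
  have hval : ∀ k, hA.eigenvalues (e k) = hA.eigenvalues₀ k := fun k => by
    simp [IsHermitian.eigenvalues, he]
  have hanti := hA.eigenvalues₀_antitone
  have hdot : ∀ x y : EuclideanSpace ℝ ι, inner ℝ x y = (⇑x : ι → ℝ) ⬝ᵥ ⇑y := fun x y => by
    simp [PiLp.inner_apply, dotProduct, mul_comm]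
  have hss : secondSmallestEigenvalue A hA = hA.eigenvalues₀ ⟨Fintype.card ι - 2, by omega⟩ := by
    rw [secondSmallestEigenvalue, dif_pos hcard]
  refine ⟨fun i => ⇑(hA.eigenvectorBasis i), hA.eigenvalues, e ⟨Fintype.card ι - 2, by omega⟩,
    e ⟨Fintype.card ι - 1, by omega⟩, fun i j => ?_, fun f => ?_, hA.mulVec_eigenvectorBasis,
    ?_, ?_, ?_, fun i hi => ?_⟩
  · rw [← hdot]
    exact orthonormal_iff_ite.1 hA.eigenvectorBasis.orthonormal i j
  · have h := hA.eigenvectorBasis.sum_repr' (WithLp.toLp 2 f)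
    have h' := congrArg (fun x : EuclideanSpace ℝ ι => (⇑x : ι → ℝ)) h
    simp only [hdot] at h'
    simpa using h'.symm
  · simp only [ne_eq, e.injective.eq_iff, Fin.mk.injEq]
    omega
  · rw [hval, hss]
  · rw [hval, hval]
    exact hanti (Fin.mk_le_mk.2 (by omega))
  · obtain ⟨k, rfl⟩ := e.surjective i
    rw [hval, hss]
    refine hanti (Fin.mk_le_mk.2 ?_)
    have : (k : ℕ) ≠ Fintype.card ι - 1 := fun h => hi (congrArg e (Fin.ext h))
    omega

theorem eigenvalue_mul_dotProduct_one {κ : Type u} [Fintype κ] {A : Matrix κ κ ℝ}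
    (hA : A.IsHermitian) (hker : A *ᵥ (fun _ => 1) = 0) {v : κ → ℝ} {c : ℝ}
    (hv : A *ᵥ v = c • v) : c * (v ⬝ᵥ (fun _ => 1)) = 0 := by
  have hT : Aᵀ = A := by rw [← conjTranspose_eq_transpose_of_trivial, hA.eq]
  rw [← smul_eq_mul, ← smul_dotProduct, ← hv, ← hT, mulVec_transpose, ← dotProduct_mulVec, hker,
    dotProduct_zero]

/-- For a positive semidefinite matrix that kills the constants, the second smallest eigenvalue is a
lower bound for the Rayleigh quotient on vectors with sum zero. -/
theorem secondSmallestEigenvalue_mul_le (hA : A.IsHermitian) (hcard : 2 ≤ Fintype.card ι)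
    (hpsd : ∀ f, 0 ≤ f ⬝ᵥ A *ᵥ f) (hker : A *ᵥ (fun _ => 1) = 0) (f : ι → ℝ)
    (hf : ∑ i, f i = 0) :
    secondSmallestEigenvalue A hA * (f ⬝ᵥ f) ≤ f ⬝ᵥ A *ᵥ f := by
  obtain ⟨v, ev, p, q, horth, hexp, hev, -, hp, -, hle⟩ :=
    exists_eigenbasis_secondSmallestEigenvalue hA hcard
  set lam := secondSmallestEigenvalue A hA
  have hAf : f ⬝ᵥ A *ᵥ f = ∑ i, ev i * (v i ⬝ᵥ f) ^ 2 := by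
    conv_lhs => rw [hexp f]
    simp only [mulVec_sum, mulVec_smul, hev, sum_dotProduct, dotProduct_sum, smul_dotProduct,
      dotProduct_smul, horth, smul_eq_mul]
    simp only [mul_ite, mul_one, mul_zero, Finset.sum_ite_eq', Finset.mem_univ, if_true]
    refine Finset.sum_congr rfl fun i _ => by ring
  have hff : f ⬝ᵥ f = ∑ i, (v i ⬝ᵥ f) ^ 2 := by
    conv_lhs => rw [hexp f]
    simp only [sum_dotProduct, dotProduct_sum, smul_dotProduct,
      dotProduct_smul, horth, smul_eq_mul]
    simp only [mul_ite, mul_one, mul_zero, Finset.sum_ite_eq', Finset.mem_univ, if_true]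
    refine Finset.sum_congr rfl fun i _ => by ring
  rcases le_or_gt lam 0 with h0 | h0
  · refine le_trans (mul_nonpos_of_nonpos_of_nonneg h0 ?_) (hpsd f)
    rw [hff]; positivity
  -- a positive second eigenvalue leaves no room in the kernel for anything but the constants
  have hone : ∀ i, i ≠ q → v i ⬝ᵥ (fun _ => (1 : ℝ)) = 0 := by
    intro i hi
    have := hle i hi
    rcases mul_eq_zero.1 (eigenvalue_mul_dotProduct_one hA hker (hev i)) with h | h
    · linarith
    · exact h
  have hq : v q ⬝ᵥ f = 0 := by
    have h1 := hexp (fun _ => (1 : ℝ))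
    rw [Finset.sum_eq_single q (fun i _ hi => by rw [hone i hi, zero_smul]) (by simp)] at h1
    have h2 : (fun _ => (1 : ℝ)) ⬝ᵥ f = 0 := by simpa [dotProduct] using hf
    rw [h1, smul_dotProduct, smul_eq_mul] at h2
    rcases mul_eq_zero.1 h2 with h | h
    · rw [h, zero_smul] at h1
      simpa using congrFun h1 p
    · exact h
  rw [hAf, hff, Finset.mul_sum]
  refine Finset.sum_le_sum fun i _ => ?_
  by_cases hi : i = q
  · subst hi; simp [hq]
  · exact mul_le_mul_of_nonneg_right (hle i hi) (sq_nonneg _)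

/-- For a positive semidefinite matrix that kills the constants, the second smallest eigenvalue has
an eigenvector with sum zero. -/
theorem exists_eigenvector_secondSmallestEigenvalue (hA : A.IsHermitian)
    (hcard : 2 ≤ Fintype.card ι) (hpsd : ∀ f, 0 ≤ f ⬝ᵥ A *ᵥ f) (hker : A *ᵥ (fun _ => 1) = 0) :
    ∃ f : ι → ℝ, f ≠ 0 ∧ ∑ i, f i = 0 ∧ A *ᵥ f = secondSmallestEigenvalue A hA • f := by
  obtain ⟨v, ev, p, q, horth, hexp, hev, hpq, hp, hqp, hle⟩ :=
    exists_eigenbasis_secondSmallestEigenvalue hA hcard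
  rw [← hp]
  have hnonneg : ∀ i, 0 ≤ ev i := fun i => by
    have := hpsd (v i)
    rwa [hev, dotProduct_smul, horth, if_pos rfl, smul_eq_mul, mul_one] at this
  have hne : ∀ i, v i ≠ 0 := fun i h => by
    have := horth i i
    simp [h] at this
  have hsum : ∀ i, ev i * ∑ j, v i j = 0 := by
    intro i
    simpa [dotProduct] using eigenvalue_mul_dotProduct_one hA hker (hev i)
  by_cases hs : ∑ j, v p j = 0
  · exact ⟨v p, hne p, hs, hev p⟩
  -- otherwise the kernel contains `v p` and `v q`, and a combination of them has sum zero
  have hp0 : ev p = 0 := (mul_eq_zero.1 (hsum p)).resolve_right hs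
  have hq0 : ev q = 0 := le_antisymm (hqp.trans hp0.le) (hnonneg q)
  refine ⟨(∑ j, v q j) • v p - (∑ j, v p j) • v q, fun h => hs ?_, ?_, ?_⟩
  · have := congrArg (fun g => v q ⬝ᵥ g) h
    simpa [dotProduct_sub, dotProduct_smul, horth, hpq, hpq.symm] using this
  · simp only [Pi.sub_apply, Pi.smul_apply, smul_eq_mul, Finset.sum_sub_distrib, ← Finset.mul_sum]
    ring
  · simp [mulVec_sub, mulVec_smul, hev, hp0, hq0]

end Spectral

/-! ### The octopus inequality for stars with at most three legs -/

section Octopus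

open Equiv

variable {V : Type u} [Fintype V] [DecidableEq V]

/-- The quadratic form of `1 - (i j)` acting by left multiplication on functions on `Perm V`. -/
noncomputable def swapForm (f : Perm V → ℝ) (i j : V) : ℝ :=
  ∑ σ, f σ * (f σ - f (swap i j * σ))

theorem swapForm_comm (f : Perm V → ℝ) (i j : V) : swapForm f i j = swapForm f j i := by
  simp [swapForm, swap_comm]

theorem swapForm_nonneg (f : Perm V → ℝ) (i j : V) : 0 ≤ swapForm f i j := by
  have h : ∑ σ, f (swap i j * σ) ^ 2 = ∑ σ, f σ ^ 2 :=
    Equiv.sum_comp (Equiv.mulLeft (swap i j)) (fun σ => f σ ^ 2)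
  have h2 : swapForm f i j = (∑ σ, (f σ - f (swap i j * σ)) ^ 2) / 2 := by
    have : ∑ σ, (f σ - f (swap i j * σ)) ^ 2
        = ∑ σ, f σ ^ 2 + ∑ σ, f (swap i j * σ) ^ 2 - 2 * ∑ σ, f σ * f (swap i j * σ) := by
      rw [Finset.mul_sum, ← Finset.sum_add_distrib, ← Finset.sum_sub_distrib]
      exact Finset.sum_congr rfl fun σ _ => by ring
    rw [this, h, swapForm]
    simp only [mul_sub, Finset.sum_sub_distrib, ← sq]
    ring
  rw [h2]
  positivity

/-- The matrix coefficient `⟨f, g • f⟩` of the action of a group `H` on functions on `Perm V`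
through a homomorphism `Ψ : H →* Perm V` and left multiplication. -/
noncomputable def matrixCoeff {H : Type*} [Group H] (Ψ : H →* Perm V) (f : Perm V → ℝ) (g : H) :
    ℝ :=
  ∑ σ, f σ * f (Ψ g * σ)

variable {H : Type*} [Group H] (Ψ : H →* Perm V) (f : Perm V → ℝ)

theorem sum_mul_eq_matrixCoeff (g h : H) :
    ∑ σ, f (Ψ g * σ) * f (Ψ h * σ) = matrixCoeff Ψ f (h * g⁻¹) := by
  rw [matrixCoeff, ← Equiv.sum_comp (Equiv.mulLeft (Ψ g)) fun σ => f σ * f (Ψ (h * g⁻¹) * σ)]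
  simp [← mul_assoc, ← map_mul]

theorem matrixCoeff_inv (g : H) : matrixCoeff Ψ f g⁻¹ = matrixCoeff Ψ f g := by
  rw [← one_mul g⁻¹, ← sum_mul_eq_matrixCoeff, matrixCoeff]
  simp [mul_comm]

theorem sum_sq_eq_matrixCoeff {n : ℕ} (w : Fin n → ℝ) (s : Fin n → H) :
    ∑ σ, (∑ a, w a * f (Ψ (s a) * σ)) ^ 2
      = ∑ a, ∑ b, w a * w b * matrixCoeff Ψ f (s b * (s a)⁻¹) := by
  simp_rw [← sum_mul_eq_matrixCoeff, sq, Finset.sum_mul_sum, Finset.mul_sum]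
  rw [Finset.sum_comm]
  refine Finset.sum_congr rfl fun a _ => ?_
  rw [Finset.sum_comm]
  exact Finset.sum_congr rfl fun b _ => Finset.sum_congr rfl fun σ _ => by ring

/-- If `‖T f‖ ≤ r ‖f‖` then `⟨f, (r + T) f⟩ ≥ 0`, for a linear combination `T` of group elements. -/
theorem add_matrixCoeff_nonneg {n : ℕ} (w : Fin n → ℝ) (s : Fin n → H) {r : ℝ} (hr : 0 ≤ r)
    (h : ∑ a, ∑ b, w a * w b * matrixCoeff Ψ f (s b * (s a)⁻¹) ≤ r ^ 2 * matrixCoeff Ψ f 1) :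
    0 ≤ r * matrixCoeff Ψ f 1 + ∑ a, w a * matrixCoeff Ψ f (s a) := by
  have hN : matrixCoeff Ψ f 1 = ∑ σ, f σ ^ 2 := by simp [matrixCoeff, sq]
  have hN0 : 0 ≤ matrixCoeff Ψ f 1 := by rw [hN]; positivity
  have hT : ∑ a, w a * matrixCoeff Ψ f (s a) = ∑ σ, f σ * ∑ a, w a * f (Ψ (s a) * σ) := by
    simp_rw [matrixCoeff, Finset.mul_sum]
    rw [Finset.sum_comm]
    exact Finset.sum_congr rfl fun σ _ => Finset.sum_congr rfl fun a _ => by ring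
  have hCS := Finset.sum_mul_sq_le_sq_mul_sq Finset.univ f
    (fun σ => ∑ a, w a * f (Ψ (s a) * σ))
  rw [← hT, ← hN, sum_sq_eq_matrixCoeff] at hCS
  have h2 : (∑ a, w a * matrixCoeff Ψ f (s a)) ^ 2 ≤ (r * matrixCoeff Ψ f 1) ^ 2 := by
    nlinarith [mul_le_mul_of_nonneg_left h hN0]
  linarith [(abs_le.1 (abs_le_of_sq_le_sq h2 (mul_nonneg hr hN0))).1]

/-- An embedding of `Fin n` transports its permutations, and sends transpositions to
transpositions. -/
theorem exists_hom_map_swap {W : Type*} [DecidableEq W] {n : ℕ} (p : Fin n ↪ W) :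
    ∃ Ψ : Perm (Fin n) →* Perm W, ∀ a b, Ψ (swap a b) = swap (p a) (p b) := by
  refine ⟨Perm.viaEmbeddingHom p, fun a b => ?_⟩
  ext y
  rw [Perm.viaEmbeddingHom_apply]
  by_cases hy : y ∈ Set.range p
  · obtain ⟨c, rfl⟩ := hy
    rw [Perm.viaEmbedding_apply, p.swap_apply]
  · rw [Perm.viaEmbedding_apply_of_notMem _ _ _ hy, swap_apply_of_ne_of_ne] <;>
      rintro rfl <;> exact hy ⟨_, rfl⟩

theorem swapForm_eq_matrixCoeff {n : ℕ} {p : Fin n ↪ V} {Ψ : Perm (Fin n) →* Perm V}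
    (hΨ : ∀ a b, Ψ (swap a b) = swap (p a) (p b)) (a b : Fin n) :
    swapForm f (p a) (p b) = matrixCoeff Ψ f 1 - matrixCoeff Ψ f (swap a b) := by
  simp [swapForm, matrixCoeff, hΨ, mul_sub, Finset.sum_sub_distrib]

/-- The octopus inequality for a star with centre `x` and three legs of weights `a`, `b`, `c`. For
`T = 2 ∑_{i < j} cᵢ cⱼ (i j)`, where the `cᵢ` are `-(a + b + c), a, b, c`, the difference
`(∑ cᵢ²)² ‖f‖² - ‖T f‖²` is `(a + b + c) a b c ‖P (1 - ρ) f‖²`, with `P` the sum of the Klein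
four-group and `ρ` a 3-cycle. -/
theorem octopus_three {x i j l : V} (hxi : x ≠ i) (hxj : x ≠ j) (hxl : x ≠ l) (hij : i ≠ j)
    (hil : i ≠ l) (hjl : j ≠ l) {a b c : ℝ} (ha : 0 ≤ a) (hb : 0 ≤ b) (hc : 0 ≤ c) :
    a * b * swapForm f i j + a * c * swapForm f i l + b * c * swapForm f j l ≤
      (a + b + c) * (a * swapForm f x i + b * swapForm f x j + c * swapForm f x l) := by
  obtain ⟨p, hp⟩ : ∃ p : Fin 4 ↪ V, ⇑p = ![x, i, j, l] := ⟨⟨![x, i, j, l], by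
    intro y z
    fin_cases y <;> fin_cases z <;> simp [hxi, hxj, hxl, hij, hil, hjl, hxi.symm, hxj.symm,
      hxl.symm, hij.symm, hil.symm, hjl.symm]⟩, rfl⟩
  obtain ⟨Ψ, hΨ⟩ := exists_hom_map_swap p
  -- representatives of the classes `{g, g⁻¹}` in the alternating group, on which `matrixCoeff` is
  -- constant: the Klein four-group, then one 3-cycle for each fixed point
  let el : Fin 8 → Perm (Fin 4) := ![1, swap 0 1 * swap 2 3, swap 0 2 * swap 1 3,
    swap 0 3 * swap 1 2, swap 1 2 * swap 2 3, swap 0 2 * swap 2 3, swap 0 1 * swap 1 3,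
    swap 0 1 * swap 1 2]
  -- `s` lists the group elements in `T`, and `t` those in `P (1 - ρ)`; the tables `ms` and `mt`
  -- give the classes of the quotients that occur in `‖T f‖²` and `‖P (1 - ρ) f‖²`
  let s : Fin 6 → Perm (Fin 4) := ![swap 0 1, swap 0 2, swap 0 3, swap 1 2, swap 1 3, swap 2 3]
  let t : Fin 8 → Perm (Fin 4) :=
    ![1, el 1, el 2, el 3, el 7, el 1 * el 7, el 2 * el 7, el 3 * el 7]
  let ms : Fin 6 → Fin 6 → Fin 8 :=
    ![![0, 7, 6, 7, 6, 1], ![7, 0, 5, 7, 2, 5], ![6, 5, 0, 3, 6, 5], ![7, 7, 3, 0, 4, 4],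
      ![6, 2, 6, 4, 0, 4], ![1, 5, 5, 4, 4, 0]]
  let mt : Fin 8 → Fin 8 → Fin 8 :=
    ![![0, 1, 2, 3, 7, 4, 6, 5], ![1, 0, 3, 2, 5, 6, 4, 7], ![2, 3, 0, 1, 4, 7, 5, 6],
      ![3, 2, 1, 0, 6, 5, 7, 4], ![7, 5, 4, 6, 0, 1, 2, 3], ![4, 6, 7, 5, 1, 0, 3, 2],
      ![6, 4, 5, 7, 2, 3, 0, 1], ![5, 7, 6, 4, 3, 2, 1, 0]]
  have hcoeff : ∀ {g h : Perm (Fin 4)}, g = h ∨ g = h⁻¹ →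
      matrixCoeff Ψ f g = matrixCoeff Ψ f h := by
    rintro g h (rfl | rfl)
    · rfl
    · exact matrixCoeff_inv Ψ f h
  have hs : ∀ y z, matrixCoeff Ψ f (s z * (s y)⁻¹) = matrixCoeff Ψ f (el (ms y z)) :=
    fun y z => hcoeff (by revert y z; decide)
  have ht : ∀ y z, matrixCoeff Ψ f (t z * (t y)⁻¹) = matrixCoeff Ψ f (el (mt y z)) :=
    fun y z => hcoeff (by revert y z; decide)
  set w : Fin 6 → ℝ := ![-2 * (a + b + c) * a, -2 * (a + b + c) * b, -2 * (a + b + c) * c,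
    2 * a * b, 2 * a * c, 2 * b * c] with hw
  set w' : Fin 8 → ℝ := ![1, 1, 1, 1, -1, -1, -1, -1] with hw'
  have hsq : 0 ≤ ∑ y, ∑ z, w' y * w' z * matrixCoeff Ψ f (el (mt y z)) := by
    simp_rw [← ht]
    rw [← sum_sq_eq_matrixCoeff]
    positivity
  have key := add_matrixCoeff_nonneg Ψ f w s (r := (a + b + c) ^ 2 + a ^ 2 + b ^ 2 + c ^ 2)
    (by positivity) (by
      have h0 : 0 ≤ (a + b + c) * a * b * c := by positivity
      have h1 := mul_nonneg h0 hsq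
      simp_rw [hs]
      have h2 : el 0 = 1 := rfl
      rw [← h2]
      simp [Fin.sum_univ_succ, hw, hw', mt, ms] at h1 ⊢
      linarith)
  have e := swapForm_eq_matrixCoeff f hΨ
  have e1 := e 0 1
  have e2 := e 0 2
  have e3 := e 0 3
  have e4 := e 1 2
  have e5 := e 1 3
  have e6 := e 2 3
  simp [hp] at e1 e2 e3 e4 e5 e6
  rw [e1, e2, e3, e4, e5, e6]
  simp [Fin.sum_univ_succ, hw, s] at key
  linarith

/-- The octopus inequality for a star with two legs. With `c = (-(a + b), a, b)` and
`T = 2 ∑_{i < j} cᵢ cⱼ (i j)`, the relation `c₀ + c₁ + c₂ = 0` gives `T ^ 2 = (∑ cᵢ²) ^ 2`: in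
particular the coefficient of the 3-cycles is a multiple of `c₀ + c₁ + c₂`. So the signs of the
weights play no role. -/
theorem octopus_two {x i j : V} (hxi : x ≠ i) (hxj : x ≠ j) (hij : i ≠ j) (a b : ℝ) :
    a * b * swapForm f i j ≤ (a + b) * (a * swapForm f x i + b * swapForm f x j) := by
  obtain ⟨p, hp⟩ : ∃ p : Fin 3 ↪ V, ⇑p = ![x, i, j] := ⟨⟨![x, i, j], by
    intro y z
    fin_cases y <;> fin_cases z <;> simp [hxi, hxj, hij, hxi.symm, hxj.symm, hij.symm]⟩, rfl⟩
  obtain ⟨Ψ, hΨ⟩ := exists_hom_map_swap p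
  let s : Fin 3 → Perm (Fin 3) := ![swap 0 1, swap 0 2, swap 1 2]
  set w : Fin 3 → ℝ := ![-2 * (a + b) * a, -2 * (a + b) * b, 2 * a * b] with hw
  -- two different transpositions have one of the two 3-cycles as their quotient
  let ρ : Perm (Fin 3) := swap 0 1 * swap 1 2
  have hρ : ∀ y z, matrixCoeff Ψ f (s z * (s y)⁻¹)
      = if y = z then matrixCoeff Ψ f 1 else matrixCoeff Ψ f ρ := by
    intro y z
    split_ifs with h
    · rw [h, mul_inv_cancel]
    · have : s z * (s y)⁻¹ = ρ ∨ s z * (s y)⁻¹ = ρ⁻¹ := by revert y z; decide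
      rcases this with h | h
      · rw [h]
      · rw [h, matrixCoeff_inv]
  have key := add_matrixCoeff_nonneg Ψ f w s (r := (a + b) ^ 2 + a ^ 2 + b ^ 2)
    (by positivity) (by
      simp_rw [hρ]
      apply le_of_eq
      simp [Fin.sum_univ_succ, hw]
      ring)
  have e := swapForm_eq_matrixCoeff f hΨ
  have e1 := e 0 1
  have e2 := e 0 2
  have e3 := e 1 2
  simp [hp] at e1 e2 e3
  rw [e1, e2, e3]
  simp [Fin.sum_univ_succ, hw, s] at key
  linarith

end Octopus

/-! ### Laplacians as operators and their spectral gaps -/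

namespace EdgeWeights

open Equiv Matrix

variable {V : Type u} [Fintype V] [DecidableEq V] (α : EdgeWeights V)

theorem randomWalkLaplacian_mulVec (g : V → ℝ) (v : V) :
    (α.randomWalkLaplacian *ᵥ g) v = ∑ u, α.weight v u * (g v - g u) := by
  rw [mulVec, dotProduct, ← Finset.add_sum_erase _ _ (Finset.mem_univ v),
    ← Finset.add_sum_erase _ (fun u => α.weight v u * (g v - g u)) (Finset.mem_univ v)]
  simp only [randomWalkLaplacian, of_apply, if_true, sub_self, mul_zero, zero_add, Finset.sum_mul]
  rw [← Finset.sum_add_distrib]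
  refine Finset.sum_congr rfl fun u hu => ?_
  rw [if_neg (Finset.ne_of_mem_erase hu).symm]
  ring

theorem interchangeLaplacian_mulVec (f : Perm V → ℝ) (σ : Perm V) :
    (α.interchangeLaplacian *ᵥ f) σ
      = 1 / 2 * ∑ i, ∑ j, α.weight i j * (f σ - f (swap i j * σ)) := by
  simp only [mulVec, dotProduct, interchangeLaplacian, of_apply, mul_assoc, ← Finset.mul_sum,
    Finset.sum_mul]
  congr 1
  rw [Finset.sum_comm]
  refine Finset.sum_congr rfl fun i _ => ?_
  rw [Finset.sum_comm]
  refine Finset.sum_congr rfl fun j _ => ?_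
  rw [← Finset.mul_sum]
  simp [sub_mul, Finset.sum_sub_distrib]

theorem dotProduct_randomWalkLaplacian (g : V → ℝ) :
    g ⬝ᵥ α.randomWalkLaplacian *ᵥ g = 1 / 2 * ∑ i, ∑ j, α.weight i j * (g i - g j) ^ 2 := by
  have h1 : g ⬝ᵥ α.randomWalkLaplacian *ᵥ g = ∑ i, ∑ j, α.weight i j * (g i * (g i - g j)) := by
    simp only [dotProduct, randomWalkLaplacian_mulVec, Finset.mul_sum]
    exact Finset.sum_congr rfl fun i _ => Finset.sum_congr rfl fun j _ => by ring
  have h2 : g ⬝ᵥ α.randomWalkLaplacian *ᵥ g = ∑ i, ∑ j, α.weight i j * (g j * (g j - g i)) := by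
    rw [h1, Finset.sum_comm]
    exact Finset.sum_congr rfl fun i _ => Finset.sum_congr rfl fun j _ => by rw [α.symm]
  have h3 : ∑ i, ∑ j, α.weight i j * (g i - g j) ^ 2
      = ∑ i, ∑ j, α.weight i j * (g i * (g i - g j))
        + ∑ i, ∑ j, α.weight i j * (g j * (g j - g i)) := by
    simp only [← Finset.sum_add_distrib]
    exact Finset.sum_congr rfl fun i _ => Finset.sum_congr rfl fun j _ => by ring
  rw [h3, ← h1, ← h2]
  ring

theorem dotProduct_interchangeLaplacian (f : Perm V → ℝ) :
    f ⬝ᵥ α.interchangeLaplacian *ᵥ f = 1 / 2 * ∑ i, ∑ j, α.weight i j * swapForm f i j := by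
  simp only [dotProduct, interchangeLaplacian_mulVec, swapForm, Finset.mul_sum]
  rw [Finset.sum_comm]
  refine Finset.sum_congr rfl fun i _ => ?_
  rw [Finset.sum_comm]
  exact Finset.sum_congr rfl fun j _ => Finset.sum_congr rfl fun σ _ => by ring

theorem randomWalkLaplacian_nonneg (g : V → ℝ) : 0 ≤ g ⬝ᵥ α.randomWalkLaplacian *ᵥ g := by
  rw [dotProduct_randomWalkLaplacian]
  exact mul_nonneg (by norm_num) (Finset.sum_nonneg fun i _ => Finset.sum_nonneg fun j _ =>
    mul_nonneg (α.nonneg i j) (sq_nonneg _))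

theorem interchangeLaplacian_nonneg (f : Perm V → ℝ) :
    0 ≤ f ⬝ᵥ α.interchangeLaplacian *ᵥ f := by
  rw [dotProduct_interchangeLaplacian]
  exact mul_nonneg (by norm_num) (Finset.sum_nonneg fun i _ => Finset.sum_nonneg fun j _ =>
    mul_nonneg (α.nonneg i j) (swapForm_nonneg f i j))

theorem randomWalkLaplacian_mulVec_one : α.randomWalkLaplacian *ᵥ (fun _ => 1) = 0 := by
  ext v; simp [randomWalkLaplacian_mulVec]

theorem interchangeLaplacian_mulVec_one : α.interchangeLaplacian *ᵥ (fun _ => 1) = 0 := by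
  ext v; simp [interchangeLaplacian_mulVec]

theorem two_le_card_perm (hV : 2 ≤ Fintype.card V) : 2 ≤ Fintype.card (Perm V) := by
  rw [Fintype.card_perm]
  exact hV.trans (Nat.self_le_factorial _)

theorem randomWalkGap_mul_le (hV : 2 ≤ Fintype.card V) {g : V → ℝ} (hg : ∑ v, g v = 0) :
    α.randomWalkGap * (g ⬝ᵥ g) ≤ g ⬝ᵥ α.randomWalkLaplacian *ᵥ g :=
  secondSmallestEigenvalue_mul_le _ hV α.randomWalkLaplacian_nonneg
    α.randomWalkLaplacian_mulVec_one g hg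

theorem interchangeGap_mul_le (hV : 2 ≤ Fintype.card V) {f : Perm V → ℝ} (hf : ∑ σ, f σ = 0) :
    α.interchangeGap * (f ⬝ᵥ f) ≤ f ⬝ᵥ α.interchangeLaplacian *ᵥ f :=
  secondSmallestEigenvalue_mul_le _ (two_le_card_perm hV) α.interchangeLaplacian_nonneg
    α.interchangeLaplacian_mulVec_one f hf

theorem exists_randomWalkGap_eigenvector (hV : 2 ≤ Fintype.card V) :
    ∃ g : V → ℝ, g ≠ 0 ∧ ∑ v, g v = 0 ∧ α.randomWalkLaplacian *ᵥ g = α.randomWalkGap • g :=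
  exists_eigenvector_secondSmallestEigenvalue _ hV α.randomWalkLaplacian_nonneg
    α.randomWalkLaplacian_mulVec_one

theorem exists_interchangeGap_eigenvector (hV : 2 ≤ Fintype.card V) :
    ∃ f : Perm V → ℝ, f ≠ 0 ∧ ∑ σ, f σ = 0 ∧
      α.interchangeLaplacian *ᵥ f = α.interchangeGap • f :=
  exists_eigenvector_secondSmallestEigenvalue _ (two_le_card_perm hV)
    α.interchangeLaplacian_nonneg α.interchangeLaplacian_mulVec_one

theorem dotProduct_self_pos {ι : Type*} [Fintype ι] {f : ι → ℝ} (hf : f ≠ 0) : 0 < f ⬝ᵥ f :=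
  lt_of_le_of_ne (Finset.sum_nonneg fun _ _ => mul_self_nonneg _)
    fun h => hf (dotProduct_self_eq_zero.1 h.symm)

theorem randomWalkGap_nonneg (hV : 2 ≤ Fintype.card V) : 0 ≤ α.randomWalkGap := by
  obtain ⟨g, hg, -, he⟩ := α.exists_randomWalkGap_eigenvector hV
  have h := α.randomWalkLaplacian_nonneg g
  rw [he, dotProduct_smul, smul_eq_mul] at h
  exact nonneg_of_mul_nonneg_left h (dotProduct_self_pos hg)

/-! ### A single particle of the interchange process performs the random walk -/

/-- The generator of the interchange process, applied to a function of the position of one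
particle, is the generator of the random walk. -/
theorem half_sum_swap (h : V → ℝ) (v : V) :
    1 / 2 * ∑ i, ∑ j, α.weight i j * (h v - h (swap i j v))
      = (α.randomWalkLaplacian *ᵥ h) v := by
  have hpt : ∀ i j, α.weight i j * (h v - h (swap i j v))
      = (if i = v then α.weight v j * (h v - h j) else 0)
        + (if j = v then α.weight v i * (h v - h i) else 0) := by
    intro i j
    by_cases hi : i = v
    · subst hi
      by_cases hj : j = i
      · subst hj; simp
      · simp [hj]
    · by_cases hj : j = v
      · subst hj; simp [hi, α.symm]
      · simp [hi, hj, swap_apply_of_ne_of_ne (Ne.symm hi) (Ne.symm hj)]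
  simp only [hpt, Finset.sum_add_distrib, randomWalkLaplacian_mulVec]
  have h1 : ∑ i, ∑ j, (if i = v then α.weight v j * (h v - h j) else 0)
      = ∑ j, α.weight v j * (h v - h j) := by
    rw [Finset.sum_comm]; simp
  rw [h1]
  simp only [Finset.sum_ite_eq', Finset.mem_univ, if_true]
  ring

theorem interchangeGap_le_randomWalkGap (hV : 2 ≤ Fintype.card V) :
    α.interchangeGap ≤ α.randomWalkGap := by
  obtain ⟨h, hne, hsum, he⟩ := α.exists_randomWalkGap_eigenvector hV
  obtain ⟨v, hv⟩ : ∃ v, h v ≠ 0 := Function.ne_iff.1 hne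
  set F : Perm V → ℝ := fun σ => h (σ v) with hF
  have hF0 : F ≠ 0 := fun H => hv (by simpa [hF] using congrFun H 1)
  have hFsum : ∑ σ, F σ = 0 := by
    -- the sum does not depend on the chosen particle, and summing over the particles gives zero
    have hindep : ∀ p, ∑ σ : Perm V, h (σ p) = ∑ σ, F σ := fun p => by
      rw [← Equiv.sum_comp (Equiv.mulRight (swap v p)) (fun σ : Perm V => h (σ p))]
      simp [hF]
    have htot : ∑ p, ∑ σ : Perm V, h (σ p) = 0 := by
      rw [Finset.sum_comm]
      exact Finset.sum_eq_zero fun σ _ => (Equiv.sum_comp σ h).trans hsum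
    simp only [hindep, Finset.sum_const, Finset.card_univ, nsmul_eq_mul] at htot
    exact (mul_eq_zero.1 htot).resolve_left (by positivity)
  have hLF : α.interchangeLaplacian *ᵥ F = α.randomWalkGap • F := by
    ext σ
    have := congrFun he (σ v)
    rw [← half_sum_swap] at this
    simpa [interchangeLaplacian_mulVec, hF] using this
  have := α.interchangeGap_mul_le hV hFsum
  rw [hLF, dotProduct_smul, smul_eq_mul] at this
  exact le_of_mul_le_mul_right this (dotProduct_self_pos hF0)

/-- The sum of `f` over the configurations with particle `p` at `v`. -/
noncomputable def marginal (f : Perm V → ℝ) (p v : V) : ℝ :=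
  ∑ σ : Perm V, if σ p = v then f σ else 0

theorem marginal_swap_mul (f : Perm V → ℝ) (p v i j : V) :
    marginal (fun σ => f (swap i j * σ)) p v = marginal f p (swap i j v) := by
  rw [marginal, marginal, ← Equiv.sum_comp (Equiv.mulLeft (swap i j))]
  refine Finset.sum_congr rfl fun σ _ => ?_
  simp [Equiv.swap_apply_eq_iff]

/-- The marginals of an eigenvector for the interchange process are eigenvectors for the random
walk unless they vanish. So only eigenvectors with vanishing marginals need to be treated. -/
theorem randomWalkGap_le_interchangeGap_of_marginal (hV : 2 ≤ Fintype.card V)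
    (hmarg : ∀ f : Perm V → ℝ, f ≠ 0 → ∑ σ, f σ = 0 →
      α.interchangeLaplacian *ᵥ f = α.interchangeGap • f → (∀ p v, marginal f p v = 0) →
        α.randomWalkGap ≤ α.interchangeGap) :
    α.randomWalkGap ≤ α.interchangeGap := by
  obtain ⟨f, hne, hsum, he⟩ := α.exists_interchangeGap_eigenvector hV
  by_cases h0 : ∀ p v, marginal f p v = 0
  · exact hmarg f hne hsum he h0
  push Not at h0
  obtain ⟨p, v, hpv⟩ := h0
  have hg0 : marginal f p ≠ 0 := fun H => hpv (congrFun H v)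
  have hgsum : ∑ u, marginal f p u = 0 := by
    simp only [marginal]
    rw [Finset.sum_comm]
    simpa using hsum
  have hLg : α.randomWalkLaplacian *ᵥ marginal f p = α.interchangeGap • marginal f p := by
    ext u
    rw [← half_sum_swap]
    have h1 : marginal (α.interchangeLaplacian *ᵥ f) p u
        = 1 / 2 * ∑ i, ∑ j, α.weight i j * (marginal f p u - marginal f p (swap i j u)) := by
      have hij : ∀ i j, α.weight i j * (marginal f p u - marginal f p (swap i j u))
          = ∑ σ : Perm V, if σ p = u then α.weight i j * (f σ - f (swap i j * σ)) else 0 := by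
        intro i j
        rw [← marginal_swap_mul, marginal, marginal, ← Finset.sum_sub_distrib, Finset.mul_sum]
        exact Finset.sum_congr rfl fun σ _ => by split_ifs <;> simp
      simp only [hij]
      rw [Finset.sum_congr rfl fun i _ => Finset.sum_comm, Finset.sum_comm, Finset.mul_sum]
      refine Finset.sum_congr rfl fun σ _ => ?_
      by_cases h : σ p = u <;> simp [h, interchangeLaplacian_mulVec]
    rw [← h1, he]
    simp [marginal, Finset.mul_sum]
  have := α.randomWalkGap_mul_le hV hgsum
  rw [hLg, dotProduct_smul, smul_eq_mul] at this
  exact le_of_mul_le_mul_right this (dotProduct_self_pos hg0)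

theorem aldousHolds_of_card_eq_two (hV : Fintype.card V = 2) : α.AldousHolds := by
  refine le_antisymm (α.interchangeGap_le_randomWalkGap hV.ge)
    (α.randomWalkGap_le_interchangeGap_of_marginal hV.ge fun f hne _ _ h0 => ?_)
  refine absurd (funext fun σ => ?_) hne
  obtain ⟨p⟩ : Nonempty V := Fintype.card_pos_iff.1 (by omega)
  -- on two vertices the position of one particle determines the configuration
  have huniq : ∀ π : Perm V, π p = σ p → π = σ := by
    intro π hπ
    ext q
    by_contra hq
    have hqp : q ≠ p := by rintro rfl; exact hq hπ
    have : 2 < Fintype.card V := Fintype.two_lt_card_iff.2 ⟨σ p, π q, σ q,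
      fun h => hqp (π.injective (h.symm.trans hπ.symm)), fun h => hqp (σ.injective h.symm), hq⟩
    omega
  have := h0 p (σ p)
  rw [marginal, Finset.sum_eq_single σ (fun π _ hπ => if_neg fun h => hπ (huniq π h)) (by simp)]
    at this
  simpa using this

end EdgeWeights

/-! ### Eliminating a vertex -/

namespace EdgeWeights

open Equiv Matrix

variable {V : Type u} [Fintype V] [DecidableEq V] (α : EdgeWeights V) (x : V)

/-- The total rate at `x`. -/
noncomputable def rate : ℝ := ∑ k : {v // v ≠ x}, α.weight x k

theorem rate_nonneg : 0 ≤ α.rate x := Finset.sum_nonneg fun k _ => α.nonneg x k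

/-- The weights of the electrical network obtained from `α` by eliminating the vertex `x`
(the Schur complement of its Laplacian). If no edge leaves `x`, the quotient is `0 / 0 = 0` and the
weights are simply restricted. -/
noncomputable def eliminate : EdgeWeights {v // v ≠ x} where
  weight i j := α.weight i j + α.weight x i * α.weight x j / α.rate x
  symm i j := by rw [α.symm i j, mul_comm (α.weight x i)]
  nonneg i j := add_nonneg (α.nonneg _ _)
    (div_nonneg (mul_nonneg (α.nonneg _ _) (α.nonneg _ _)) (α.rate_nonneg x))

variable {α x}

theorem weight_eq_zero_of_rate_eq_zero (h : α.rate x = 0) (i : {v // v ≠ x}) :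
    α.weight x i = 0 :=
  le_antisymm (h.le.trans' (Finset.single_le_sum (f := fun k : {v // v ≠ x} => α.weight x k)
    (fun k _ => α.nonneg x k) (Finset.mem_univ i))) (α.nonneg x i)

theorem half_sum_eq_add (Q : V → V → ℝ) (hQ : ∀ i j, Q i j = Q j i) (hx : Q x x = 0) :
    1 / 2 * ∑ i, ∑ j, Q i j
      = ∑ i : {v // v ≠ x}, Q x i
        + 1 / 2 * ∑ i : {v // v ≠ x}, ∑ j : {v // v ≠ x}, Q i j := by
  simp only [fun f : V → ℝ => Fintype.sum_eq_add_sum_subtype_ne f x, hx,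
    Finset.sum_add_distrib, fun i : {v // v ≠ x} => hQ i x]
  ring

/-- The energy of the random walk on the star at `x` is minimal when the value at `x` is the
weighted mean of the others; the minimum is the energy of the network replacing the star. -/
theorem sum_weight_mul_sub_mean_sq (h : {v // v ≠ x} → ℝ) :
    ∑ i : {v // v ≠ x}, α.weight x i *
        ((∑ k : {v // v ≠ x}, α.weight x k * h k) / α.rate x - h i) ^ 2
      = 1 / 2 * ∑ i : {v // v ≠ x}, ∑ j : {v // v ≠ x},
          α.weight x i * α.weight x j / α.rate x * (h i - h j) ^ 2 := by
  rcases eq_or_ne (α.rate x) 0 with h0 | h0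
  · simp [weight_eq_zero_of_rate_eq_zero h0]
  set S := ∑ k : {v // v ≠ x}, α.weight x k * h k with hS
  set T := ∑ k : {v // v ≠ x}, α.weight x k * h k ^ 2 with hT
  have h1 : ∑ i : {v // v ≠ x}, α.weight x i * (S / α.rate x - h i) ^ 2
      = (S / α.rate x) ^ 2 * α.rate x - 2 * (S / α.rate x) * S + T := by
    rw [hS, hT, rate, Finset.mul_sum, Finset.mul_sum, ← Finset.sum_sub_distrib,
      ← Finset.sum_add_distrib]
    exact Finset.sum_congr rfl fun i _ => by ring
  have h2 : ∑ i : {v // v ≠ x}, ∑ j : {v // v ≠ x},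
      α.weight x i * α.weight x j / α.rate x * (h i - h j) ^ 2
      = (T * α.rate x + α.rate x * T - 2 * (S * S)) / α.rate x := by
    have e1 : T * α.rate x = ∑ i : {v // v ≠ x}, ∑ j : {v // v ≠ x},
        α.weight x i * h i ^ 2 * α.weight x j := by rw [hT, rate, Finset.sum_mul_sum]
    have e2 : α.rate x * T = ∑ i : {v // v ≠ x}, ∑ j : {v // v ≠ x},
        α.weight x i * (α.weight x j * h j ^ 2) := by rw [hT, rate, Finset.sum_mul_sum]
    have e3 : S * S = ∑ i : {v // v ≠ x}, ∑ j : {v // v ≠ x},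
        α.weight x i * h i * (α.weight x j * h j) := by rw [hS, Finset.sum_mul_sum]
    rw [e1, e2, e3]
    simp only [Finset.mul_sum, ← Finset.sum_add_distrib, ← Finset.sum_sub_distrib,
      Finset.sum_div]
    exact Finset.sum_congr rfl fun i _ => Finset.sum_congr rfl fun j _ => by ring
  rw [h1, h2]
  field_simp
  ring

theorem card_ne (x : V) : Fintype.card {v // v ≠ x} + 1 = Fintype.card V := by
  have : 0 < Fintype.card V := Fintype.card_pos_iff.2 ⟨x⟩
  simp only [ne_eq, Fintype.card_subtype_compl, Fintype.card_subtype_eq]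
  omega

/-- Eliminating a vertex does not decrease the gap of the random walk: harmonic extension turns an
eigenvector of the smaller network into a test function with the same energy. -/
theorem randomWalkGap_le_eliminate (hW : 2 ≤ Fintype.card {v // v ≠ x}) :
    α.randomWalkGap ≤ (α.eliminate x).randomWalkGap := by
  have hV : 2 ≤ Fintype.card V := by have := card_ne x; omega
  obtain ⟨h, hne, hsum, he⟩ := (α.eliminate x).exists_randomWalkGap_eigenvector hW
  set b := (∑ k : {v // v ≠ x}, α.weight x k * h k) / α.rate x with hb
  set N : ℝ := (Fintype.card V : ℝ) with hN
  have hN2 : (2 : ℝ) ≤ N := by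
    rw [hN]; exact_mod_cast hV
  -- the harmonic extension of `h`, shifted by its mean
  set F : V → ℝ := fun v => (if hv : v ≠ x then h ⟨v, hv⟩ else b) - b / N with hF
  have hFx : F x = b - b / N := by simp [hF]
  have hFi : ∀ i : {v // v ≠ x}, F i = h i - b / N := fun i => by simp [hF, i.2]
  have hcard : (Fintype.card {v // v ≠ x} : ℝ) = N - 1 := by
    rw [hN, ← card_ne x]; push_cast; ring
  have hFsum : ∑ v, F v = 0 := by
    rw [Fintype.sum_eq_add_sum_subtype_ne F x, hFx]
    simp only [hFi, Finset.sum_sub_distrib, hsum, Finset.sum_const, Finset.card_univ,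
      nsmul_eq_mul, hcard]
    field_simp
    ring
  have hFF : h ⬝ᵥ h ≤ F ⬝ᵥ F := by
    simp only [dotProduct]
    rw [Fintype.sum_eq_add_sum_subtype_ne (fun v => F v * F v) x, hFx]
    have : ∑ i : {v // v ≠ x}, F i * F i
        = ∑ i : {v // v ≠ x}, h i * h i - 2 * (b / N) * ∑ i, h i + (N - 1) * (b / N) ^ 2 := by
      rw [← hcard, ← nsmul_eq_mul, ← Finset.card_univ, ← Finset.sum_const, Finset.mul_sum,
        ← Finset.sum_sub_distrib, ← Finset.sum_add_distrib]
      exact Finset.sum_congr rfl fun i _ => by rw [hFi]; ring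
    rw [this, hsum]
    have : 0 ≤ (N - 1) * (b / N) ^ 2 := mul_nonneg (by linarith) (sq_nonneg _)
    nlinarith [mul_self_nonneg (b - b / N)]
  have hE : F ⬝ᵥ α.randomWalkLaplacian *ᵥ F
      = h ⬝ᵥ (α.eliminate x).randomWalkLaplacian *ᵥ h := by
    rw [dotProduct_randomWalkLaplacian, dotProduct_randomWalkLaplacian,
      half_sum_eq_add (x := x) _ (fun i j => by rw [α.symm]; ring) (by simp)]
    have h1 := sum_weight_mul_sub_mean_sq (α := α) h
    rw [← hb] at h1
    simp only [hFx, hFi, sub_sub_sub_cancel_right, h1, eliminate, add_mul,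
      Finset.sum_add_distrib]
    ring
  have h1 := α.randomWalkGap_mul_le hV hFsum
  rw [hE, he, dotProduct_smul, smul_eq_mul] at h1
  exact le_of_mul_le_mul_right
    ((mul_le_mul_of_nonneg_left hFF (α.randomWalkGap_nonneg hV)).trans h1)
    (dotProduct_self_pos hne)

/-- The octopus inequality for `α` at `x`: in the interchange process, the star at `x` dominates
the network that replaces it. -/
def OctopusAt (α : EdgeWeights V) (x : V) : Prop :=
  ∀ f : Perm V → ℝ,
    1 / 2 * ∑ i : {v // v ≠ x}, ∑ j : {v // v ≠ x},
        α.weight x i * α.weight x j * swapForm f i j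
      ≤ α.rate x * ∑ i : {v // v ≠ x}, α.weight x i * swapForm f x i

theorem swapForm_self (f : Perm V → ℝ) (i : V) : swapForm f i i = 0 := by
  simp [swapForm, ← Perm.one_def]

theorem OctopusAt.le_dotProduct (hoct : α.OctopusAt x) (f : Perm V → ℝ) :
    1 / 2 * ∑ i : {v // v ≠ x}, ∑ j : {v // v ≠ x}, (α.eliminate x).weight i j * swapForm f i j
      ≤ f ⬝ᵥ α.interchangeLaplacian *ᵥ f := by
  rw [dotProduct_interchangeLaplacian, half_sum_eq_add (x := x) _
    (fun i j => by rw [α.symm, swapForm_comm]) (by rw [swapForm_self, mul_zero])]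
  have hstar : 1 / 2 * ∑ i : {v // v ≠ x}, ∑ j : {v // v ≠ x},
      α.weight x i * α.weight x j / α.rate x * swapForm f i j
        ≤ ∑ i : {v // v ≠ x}, α.weight x i * swapForm f x i := by
    rcases (α.rate_nonneg x).eq_or_lt with h0 | h0
    · simp [weight_eq_zero_of_rate_eq_zero h0.symm]
    · refine le_of_mul_le_mul_left (le_of_eq_of_le ?_ (hoct f)) h0
      simp only [Finset.mul_sum]
      refine Finset.sum_congr rfl fun i _ => Finset.sum_congr rfl fun j _ => ?_
      field_simp
  simp only [eliminate, add_mul, Finset.sum_add_distrib]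
  linarith

/-- The permutations of the other vertices are the permutations fixing `x`. -/
theorem sum_ofSubtype (F : Perm V → ℝ) :
    ∑ ρ : Perm {v // v ≠ x}, F (Perm.ofSubtype ρ) = ∑ π : Perm V, if π x = x then F π else 0 := by
  rw [← Finset.sum_filter, ← Equiv.sum_comp (Perm.subtypeEquivSubtypePerm (· ≠ x)).symm]
  rw [Finset.sum_subtype (p := fun π : Perm V => ∀ a, ¬ a ≠ x → π a = a) _ (by simp)]
  refine Finset.sum_congr rfl fun π _ => ?_
  have := congrArg Subtype.val ((Perm.subtypeEquivSubtypePerm (· ≠ x)).apply_symm_apply π)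
  rw [Perm.subtypeEquivSubtypePerm_apply_coe] at this
  rw [this]

/-- The coset of `σ` under the permutations fixing `x` consists of the configurations in which the
particle at `x` is the same as in `σ`. -/
theorem sum_ofSubtype_mul (f : Perm V → ℝ) (σ : Perm V) :
    ∑ ρ : Perm {v // v ≠ x}, f (Perm.ofSubtype ρ * σ) = marginal f (σ⁻¹ x) x := by
  rw [sum_ofSubtype fun π => f (π * σ), marginal, ← Equiv.sum_comp (Equiv.mulRight σ)
    fun π : Perm V => if π (σ⁻¹ x) = x then f π else 0]
  simp

theorem sum_sum_ofSubtype_mul (F : Perm V → ℝ) :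
    ∑ σ : Perm V, ∑ ρ : Perm {v // v ≠ x}, F (Perm.ofSubtype ρ * σ)
      = Fintype.card (Perm {v // v ≠ x}) * ∑ σ, F σ := by
  rw [Finset.sum_comm]
  have : ∀ ρ : Perm {v // v ≠ x}, ∑ σ : Perm V, F (Perm.ofSubtype ρ * σ) = ∑ σ, F σ :=
    fun ρ => Equiv.sum_comp (Equiv.mulLeft (Perm.ofSubtype ρ)) F
  simp [this]

/-- Lower bound for the interchange energy on functions whose marginals vanish. Such an `f` has
sum zero on each coset of the permutations fixing `x`, where the interchange process on the smaller
network acts. -/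
theorem interchangeGap_eliminate_mul_le (hW : 2 ≤ Fintype.card {v // v ≠ x})
    (hoct : α.OctopusAt x) {f : Perm V → ℝ} (hf : ∀ p v, marginal f p v = 0) :
    (α.eliminate x).interchangeGap * (f ⬝ᵥ f) ≤ f ⬝ᵥ α.interchangeLaplacian *ᵥ f := by
  refine le_trans ?_ (hoct.le_dotProduct f)
  set m : ℝ := (Fintype.card (Perm {v // v ≠ x}) : ℝ) with hm
  have hm0 : 0 < m := by rw [hm]; exact_mod_cast Fintype.card_pos
  set h : Perm V → Perm {v // v ≠ x} → ℝ := fun σ ρ => f (Perm.ofSubtype ρ * σ) with hh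
  have hnorm : ∑ σ, h σ ⬝ᵥ h σ = m * (f ⬝ᵥ f) :=
    sum_sum_ofSubtype_mul fun π => f π * f π
  have hform : ∀ i j : {v // v ≠ x}, ∑ σ, swapForm (h σ) i j = m * swapForm f i j := by
    intro i j
    rw [swapForm, hm, ← sum_sum_ofSubtype_mul]
    simp only [swapForm, hh, map_mul, Perm.ofSubtype_swap_eq, mul_assoc]
  have hle : ∑ σ, (α.eliminate x).interchangeGap * (h σ ⬝ᵥ h σ)
      ≤ ∑ σ, h σ ⬝ᵥ (α.eliminate x).interchangeLaplacian *ᵥ h σ :=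
    Finset.sum_le_sum fun σ _ => (α.eliminate x).interchangeGap_mul_le hW
      ((sum_ofSubtype_mul f σ).trans (hf _ _))
  have hright : ∑ σ, h σ ⬝ᵥ (α.eliminate x).interchangeLaplacian *ᵥ h σ
      = m * (1 / 2 * ∑ i, ∑ j, (α.eliminate x).weight i j * swapForm f i j) := by
    simp only [dotProduct_interchangeLaplacian, ← Finset.mul_sum]
    rw [Finset.sum_comm, mul_left_comm]
    congr 1
    rw [Finset.mul_sum]
    refine Finset.sum_congr rfl fun i _ => ?_
    rw [Finset.sum_comm, Finset.mul_sum]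
    refine Finset.sum_congr rfl fun j _ => ?_
    rw [← Finset.mul_sum, hform]
    ring
  rw [← Finset.mul_sum, hnorm, hright, mul_left_comm] at hle
  exact le_of_mul_le_mul_left hle hm0

theorem aldousHolds_of_eliminate (hW : 2 ≤ Fintype.card {v // v ≠ x}) (hoct : α.OctopusAt x)
    (hβ : (α.eliminate x).AldousHolds) : α.AldousHolds := by
  have hV : 2 ≤ Fintype.card V := by have := card_ne x; omega
  refine le_antisymm (α.interchangeGap_le_randomWalkGap hV)
    (α.randomWalkGap_le_interchangeGap_of_marginal hV fun f hne _ he h0 => ?_)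
  have h1 := interchangeGap_eliminate_mul_le hW hoct h0
  rw [he, dotProduct_smul, smul_eq_mul] at h1
  exact (randomWalkGap_le_eliminate hW).trans
    (hβ.symm.le.trans (le_of_mul_le_mul_right h1 (dotProduct_self_pos hne)))

/-! ### The octopus inequality at vertices of small degree -/

/-- Only the neighbours of `x` matter for the octopus inequality. -/
theorem octopusAt_of_support (S : Finset {v // v ≠ x}) (hS : ∀ i, i ∉ S → α.weight x i = 0)
    (h : ∀ f : Perm V → ℝ, 1 / 2 * ∑ i ∈ S, ∑ j ∈ S, α.weight x i * α.weight x j * swapForm f i j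
      ≤ (∑ i ∈ S, α.weight x i) * ∑ i ∈ S, α.weight x i * swapForm f x i) :
    α.OctopusAt x := by
  intro f
  refine le_of_eq_of_le ?_ ((h f).trans_eq ?_)
  · congr 1
    rw [← Finset.sum_subset (Finset.subset_univ S) fun i _ hi => by simp [hS i hi]]
    refine Finset.sum_congr rfl fun i _ => ?_
    rw [← Finset.sum_subset (Finset.subset_univ S) fun j _ hj => by simp [hS j hj]]
  · rw [rate, ← Finset.sum_subset (Finset.subset_univ S) fun i _ hi => hS i hi,
      ← Finset.sum_subset (Finset.subset_univ S) fun i _ hi => by simp [hS i hi]]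

theorem octopusAt_of_one (i : {v // v ≠ x})
    (h : ∀ v : {v // v ≠ x}, α.weight x v ≠ 0 → v = i) : α.OctopusAt x := by
  refine octopusAt_of_support {i} (fun v hv => by_contra fun h' => hv (by simp [h v h']))
    fun f => ?_
  simp only [Finset.sum_singleton, swapForm_self, mul_zero]
  exact mul_nonneg (α.nonneg _ _) (mul_nonneg (α.nonneg _ _) (swapForm_nonneg _ _ _))

theorem octopusAt_of_two {i j : {v // v ≠ x}} (hij : i ≠ j)
    (h : ∀ v : {v // v ≠ x}, α.weight x v ≠ 0 → v = i ∨ v = j) : α.OctopusAt x := by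
  refine octopusAt_of_support {i, j} (fun v hv => by_contra fun h' => hv (by simpa using h v h'))
    fun f => ?_
  have := octopus_two f i.2.symm j.2.symm (Subtype.coe_injective.ne hij)
    (α.weight x i) (α.weight x j)
  simp only [Finset.sum_pair hij, swapForm_self, swapForm_comm f j i]
  linarith

theorem octopusAt_of_three {i j l : {v // v ≠ x}} (hij : i ≠ j) (hil : i ≠ l) (hjl : j ≠ l)
    (h : ∀ v : {v // v ≠ x}, α.weight x v ≠ 0 → v = i ∨ v = j ∨ v = l) : α.OctopusAt x := by
  refine octopusAt_of_support {i, j, l}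
    (fun v hv => by_contra fun h' => hv (by simpa using h v h')) fun f => ?_
  have := octopus_three f i.2.symm j.2.symm l.2.symm (Subtype.coe_injective.ne hij)
    (Subtype.coe_injective.ne hil) (Subtype.coe_injective.ne hjl) (α.nonneg x i) (α.nonneg x j)
    (α.nonneg x l)
  have hsum : ∀ F : {v // v ≠ x} → ℝ, ∑ v ∈ {i, j, l}, F v = F i + (F j + F l) := fun F => by
    rw [Finset.sum_insert (by simp [hij, hil]), Finset.sum_pair hjl]
  simp only [hsum, swapForm_self, swapForm_comm f j i, swapForm_comm f l i, swapForm_comm f l j]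
  linarith

end EdgeWeights

/-! ### Induction along the reductions -/

namespace LooplessMultigraph

open EdgeWeights

variable {V : Type u} [DecidableEq V]

/-- The weights `α` live on the multigraph `G`, where `φ` identifies the vertices of `α` with those
of `G`. Deleting vertices of `G` shrinks the type `W`, while the ambient type `V` stays. -/
def Carries (G : LooplessMultigraph V) {W : Type u} (φ : W ↪ V) (α : EdgeWeights W) : Prop :=
  (∀ v, v ∈ G.verts ↔ ∃ w, φ w = v) ∧
    ∀ i j, i ≠ j → α.weight i j ≠ 0 → s(φ i, φ j) ∈ G.edges

/-- `G` has at least two vertices and Aldous' conjecture holds for all weights carried by `G`. -/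
def AldousGraph (G : LooplessMultigraph V) : Prop :=
  ∀ (W : Type u) [Fintype W] [DecidableEq W] (φ : W ↪ V) (α : EdgeWeights W),
    G.Carries φ α → 2 ≤ Fintype.card W ∧ α.AldousHolds

theorem IsEdge.aldousGraph {G : LooplessMultigraph V} (hG : G.IsEdge) : G.AldousGraph := by
  intro W _ _ φ α hα
  obtain ⟨u, v, huv, hverts, -⟩ := hG
  have hcard : Fintype.card W = 2 := by
    have : Finset.univ.map φ = G.verts := by
      ext w; simp [hα.1 w]
    rw [← Finset.card_univ, ← Finset.card_map φ, this, hverts, Finset.card_pair huv]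
  exact ⟨hcard.ge, α.aldousHolds_of_card_eq_two hcard⟩

theorem mem_verts_of_incident {G : LooplessMultigraph V} {k i : V} (h : s(i, k) ∈ G.incident k) :
    k ∈ G.verts ∧ i ∈ G.verts ∧ i ≠ k := by
  have he := (Multiset.mem_filter.1 h).1
  exact ⟨G.mem_verts _ he k (by simp), G.mem_verts _ he i (by simp),
    fun hik => G.loopless _ he (by simpa using hik)⟩

theorem Carries.mem_incident {G : LooplessMultigraph V} {W : Type u} {φ : W ↪ V}
    {α : EdgeWeights W} (hα : G.Carries φ α) {x i : W} (hi : i ≠ x) (h : α.weight x i ≠ 0) :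
    s(φ i, φ x) ∈ G.incident (φ x) :=
  Multiset.mem_filter.2 ⟨hα.2 i x hi (by rwa [α.symm]), by simp⟩

/-- Deleting a vertex `k` while joining its neighbours to each other. The octopus inequality at
`k` is the only analytic input. -/
theorem AldousGraph.of_eliminate {G H : LooplessMultigraph V} (hH : H.AldousGraph) {k : V}
    (hk : k ∈ G.verts) (hverts : H.verts = G.verts.erase k)
    (hrem : ∀ e ∈ G.remaining k, e ∈ H.edges)
    (hnew : ∀ i j, i ≠ j → s(i, k) ∈ G.incident k → s(j, k) ∈ G.incident k → s(i, j) ∈ H.edges)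
    (hoct : ∀ (W : Type u) [Fintype W] [DecidableEq W] (φ : W ↪ V) (α : EdgeWeights W) (x : W),
      G.Carries φ α → φ x = k → α.OctopusAt x) :
    G.AldousGraph := by
  intro W _ _ φ α hα
  obtain ⟨x, rfl⟩ := (hα.1 k).1 hk
  have hcarry : H.Carries ((Function.Embedding.subtype (· ≠ x)).trans φ) (α.eliminate x) := by
    refine ⟨fun v => ?_, fun i j hij h => ?_⟩
    · rw [hverts, Finset.mem_erase, hα.1]
      constructor
      · rintro ⟨hv, w, rfl⟩
        exact ⟨⟨w, fun h => hv (h ▸ rfl)⟩, rfl⟩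
      · rintro ⟨w, rfl⟩
        exact ⟨fun h => w.2 (φ.injective h), w, rfl⟩
    · have hij' : (i : W) ≠ j := Subtype.coe_injective.ne hij
      by_cases h0 : α.weight i j = 0
      · have hi : α.weight x i ≠ 0 := fun h' => h (by simp [eliminate, h0, h'])
        have hj : α.weight x j ≠ 0 := fun h' => h (by simp [eliminate, h0, h'])
        exact hnew _ _ (φ.injective.ne hij') (hα.mem_incident i.2 hi) (hα.mem_incident j.2 hj)
      · refine hrem _ (Multiset.mem_filter.2 ⟨hα.2 i j hij' h0, ?_⟩)
        simp [i.2.symm, j.2.symm]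
  obtain ⟨hcard, hald⟩ := hH _ _ _ hcarry
  exact ⟨by have := card_ne x; omega, aldousHolds_of_eliminate hcard (hoct W φ α x hα rfl) hald⟩

theorem Carries.exists_eq {G : LooplessMultigraph V} {W : Type u} {φ : W ↪ V}
    {α : EdgeWeights W} (hα : G.Carries φ α) {x : W} {i : V}
    (h : s(i, φ x) ∈ G.incident (φ x)) : ∃ w : {v // v ≠ x}, φ w = i := by
  obtain ⟨-, hi, hne⟩ := mem_verts_of_incident h
  obtain ⟨w, rfl⟩ := (hα.1 i).1 hi
  exact ⟨⟨w, fun h => hne (h ▸ rfl)⟩, rfl⟩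

theorem Step.aldousGraph {G H : LooplessMultigraph V} (h : Step G H) (hH : H.AldousGraph) :
    G.AldousGraph := by
  cases h with
  | parallel e he hverts hedges =>
    -- an edge of multiplicity two is still present after one copy is deleted
    intro W _ _ φ α hα
    refine hH W φ α ⟨fun v => by rw [hverts, hα.1], fun i j hij h => ?_⟩
    have hmem := hα.2 i j hij h
    rw [hedges]
    by_cases heq : s(φ i, φ j) = e
    · rw [heq, ← Multiset.count_pos, Multiset.count_erase_self]
      omega
    · exact (Multiset.mem_erase_of_ne heq).2 hmem
  | degreeOne i k hk hverts hedges =>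
    have hi : s(i, k) ∈ G.incident k := by simp [hk]
    refine hH.of_eliminate (mem_verts_of_incident hi).1 hverts (fun e he => by rwa [hedges]) ?_ ?_
    · intro a b hab ha hb
      simp only [hk, Multiset.mem_singleton, Sym2.congr_left] at ha hb
      exact absurd (ha.trans hb.symm) hab
    · rintro W _ _ φ α x hα rfl
      obtain ⟨w, rfl⟩ := hα.exists_eq hi
      refine octopusAt_of_one w fun v hv => ?_
      have := hα.mem_incident v.2 hv
      simpa [hk, Subtype.ext_iff, v.2] using this
  | series i j k hij hk hverts hedges =>
    have hi : s(i, k) ∈ G.incident k := by simp [hk]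
    have hj : s(j, k) ∈ G.incident k := by simp [hk]
    refine hH.of_eliminate (mem_verts_of_incident hi).1 hverts (fun e he => by simp [hedges, he])
      ?_ ?_
    · intro a b hab ha hb
      simp only [hk, Multiset.insert_eq_cons, Multiset.mem_cons, Multiset.mem_singleton,
        Sym2.congr_left] at ha hb
      rcases ha with rfl | rfl <;> rcases hb with rfl | rfl <;>
        simp_all [Sym2.eq_swap]
    · rintro W _ _ φ α x hα rfl
      obtain ⟨w, rfl⟩ := hα.exists_eq hi
      obtain ⟨w', rfl⟩ := hα.exists_eq hj
      refine octopusAt_of_two (i := w) (j := w') (fun h => hij (h ▸ rfl)) fun v hv => ?_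
      have := hα.mem_incident v.2 hv
      simpa [hk, Subtype.ext_iff, v.2] using this
  | starTriangle i j l k hij hil hjl hk hverts hedges =>
    have hi : s(i, k) ∈ G.incident k := by simp [hk]
    have hj : s(j, k) ∈ G.incident k := by simp [hk]
    have hl : s(l, k) ∈ G.incident k := by simp [hk]
    refine hH.of_eliminate (mem_verts_of_incident hi).1 hverts (fun e he => by simp [hedges, he])
      ?_ ?_
    · intro a b hab ha hb
      simp only [hk, Multiset.insert_eq_cons, Multiset.mem_cons, Multiset.mem_singleton,
        Sym2.congr_left] at ha hb
      rw [hedges]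
      rcases ha with rfl | rfl | rfl <;> rcases hb with rfl | rfl | rfl <;>
        first | exact absurd rfl hab | simp
    · rintro W _ _ φ α x hα rfl
      obtain ⟨w, rfl⟩ := hα.exists_eq hi
      obtain ⟨w', rfl⟩ := hα.exists_eq hj
      obtain ⟨w'', rfl⟩ := hα.exists_eq hl
      refine octopusAt_of_three (i := w) (j := w') (l := w'') (fun h => hij (h ▸ rfl))
        (fun h => hil (h ▸ rfl)) (fun h => hjl (h ▸ rfl)) fun v hv => ?_
      have := hα.mem_incident v.2 hv
      simpa [hk, Subtype.ext_iff, v.2] using this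

theorem ReducibleToEdge.aldousGraph {G : LooplessMultigraph V} (hG : G.ReducibleToEdge) :
    G.AldousGraph := by
  obtain ⟨H, hGH, hH⟩ := hG
  induction hGH using Relation.ReflTransGen.head_induction_on with
  | refl => exact hH.aldousGraph
  | head h _ ih => exact h.aldousGraph ih

theorem ReducibleToEdge.aldousHolds [Fintype V] {G : LooplessMultigraph V}
    (hverts : G.verts = Finset.univ) (hG : G.ReducibleToEdge) {α : EdgeWeights V}
    (hα : α.SupportedOn G) : α.AldousHolds :=
  (hG.aldousGraph V (Function.Embedding.refl V) α
    ⟨fun v => by simp [hverts], fun i j _ h => hα i j h⟩).2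

end LooplessMultigraph

/-! ### Reducing wheels and cycles to an edge -/

namespace LooplessMultigraph

/-- The edges of the path `p 0, p 1, …, p m`. -/
def pathEdges {V : Type u} (p : ℕ → V) (m : ℕ) : Multiset (Sym2 V) :=
  (Multiset.range m).map fun i => s(p i, p (i + 1))

/-- The edges joining `h` to `p 0, …, p (m - 1)`. -/
def spokeEdges {V : Type u} (p : ℕ → V) (h : V) (m : ℕ) : Multiset (Sym2 V) :=
  (Multiset.range m).map fun i => s(p i, h)

theorem notMem_of_mem_pathEdges {V : Type u} {p : ℕ → V} {m : ℕ}
    (hp : Set.InjOn p (Set.Iic (m + 1))) {e : Sym2 V} (he : e ∈ pathEdges p m) : p (m + 1) ∉ e := by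
  simp only [pathEdges, Multiset.mem_map, Multiset.mem_range] at he
  obtain ⟨i, hi, rfl⟩ := he
  rw [Sym2.mem_iff]
  rintro (h | h)
  · have := hp (Set.mem_Iic.2 le_rfl) (Set.mem_Iic.2 (by omega)) h
    omega
  · have := hp (Set.mem_Iic.2 le_rfl) (Set.mem_Iic.2 (by omega)) h
    omega

section Reductions

variable {V : Type u} [DecidableEq V] {G : LooplessMultigraph V}

theorem ReducibleToEdge.of_step {H : LooplessMultigraph V} (h : Step G H)
    (hH : H.ReducibleToEdge) : G.ReducibleToEdge := by
  obtain ⟨K, hHK, hK⟩ := hH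
  exact ⟨K, hHK.head h, hK⟩

theorem incident_eq_and_remaining_eq {k : V} {I R : Multiset (Sym2 V)} (hG : G.edges = I + R)
    (hI : ∀ e ∈ I, k ∈ e) (hR : ∀ e ∈ R, k ∉ e) : G.incident k = I ∧ G.remaining k = R := by
  rw [incident, remaining, hG, Multiset.filter_add, Multiset.filter_add,
    Multiset.filter_eq_self.2 hI, Multiset.filter_eq_nil.2 hR, Multiset.filter_eq_self.2 hR,
    Multiset.filter_eq_nil.2 fun e he h => h (hI e he)]
  simp

/-- Deleting `k` and adding edges between other vertices gives a loopless multigraph again. -/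
theorem exists_erase_add {k : V} {N R : Multiset (Sym2 V)} (hR : ∀ e ∈ R, e ∈ G.edges ∧ k ∉ e)
    (hN : ∀ e ∈ N, ¬ e.IsDiag ∧ ∀ v ∈ e, v ∈ G.verts ∧ v ≠ k) :
    ∃ H : LooplessMultigraph V, H.verts = G.verts.erase k ∧ H.edges = N + R := by
  refine ⟨⟨G.verts.erase k, N + R, fun e he v hv => ?_, fun e he => ?_⟩, rfl, rfl⟩
  · rw [Finset.mem_erase]
    rcases Multiset.mem_add.1 he with h | h
    · exact ((hN e h).2 v hv).symm
    · exact ⟨fun hvk => (hR e h).2 (hvk ▸ hv), G.mem_verts e (hR e h).1 v hv⟩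
  · rcases Multiset.mem_add.1 he with h | h
    · exact (hN e h).1
    · exact G.loopless e (hR e h).1

theorem ReducibleToEdge.of_series {i j k : V} {R : Multiset (Sym2 V)} (hij : i ≠ j)
    (hG : G.edges = {s(i, k), s(j, k)} + R) (hR : ∀ e ∈ R, k ∉ e)
    (h : ∀ H : LooplessMultigraph V, H.verts = G.verts.erase k → H.edges = {s(i, j)} + R →
      H.ReducibleToEdge) : G.ReducibleToEdge := by
  obtain ⟨hI, hR'⟩ := incident_eq_and_remaining_eq hG (k := k) (by simp) hR
  have hi := mem_verts_of_incident (G := G) (k := k) (i := i) (by simp [hI])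
  have hj := mem_verts_of_incident (G := G) (k := k) (i := j) (by simp [hI])
  obtain ⟨H, hv, he⟩ := exists_erase_add (G := G) (k := k) (N := {s(i, j)}) (R := R)
    (fun e he => ⟨by simp [hG, he], hR e he⟩) (by simp [hij, hi, hj])
  exact of_step (.series G H i j k hij hI hv (by rw [he, hR'])) (h H hv he)

theorem ReducibleToEdge.of_starTriangle {i j l k : V} {R : Multiset (Sym2 V)} (hij : i ≠ j)
    (hil : i ≠ l) (hjl : j ≠ l) (hG : G.edges = {s(i, k), s(j, k), s(l, k)} + R)
    (hR : ∀ e ∈ R, k ∉ e)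
    (h : ∀ H : LooplessMultigraph V, H.verts = G.verts.erase k →
      H.edges = {s(i, j), s(j, l), s(i, l)} + R → H.ReducibleToEdge) : G.ReducibleToEdge := by
  obtain ⟨hI, hR'⟩ := incident_eq_and_remaining_eq hG (k := k) (by simp) hR
  have hi := mem_verts_of_incident (G := G) (k := k) (i := i) (by simp [hI])
  have hj := mem_verts_of_incident (G := G) (k := k) (i := j) (by simp [hI])
  have hl := mem_verts_of_incident (G := G) (k := k) (i := l) (by simp [hI])
  obtain ⟨H, hv, he⟩ := exists_erase_add (G := G) (k := k) (N := {s(i, j), s(j, l), s(i, l)})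
    (R := R) (fun e he => ⟨by simp [hG, he], hR e he⟩) (by simp [hij, hil, hjl, hi, hj, hl])
  exact of_step (.starTriangle G H i j l k hij hil hjl hI hv (by rw [he, hR'])) (h H hv he)

theorem ReducibleToEdge.of_parallel {e : Sym2 V} {R : Multiset (Sym2 V)}
    (hG : G.edges = e ::ₘ R) (he : e ∈ R)
    (h : ∀ H : LooplessMultigraph V, H.verts = G.verts → H.edges = R → H.ReducibleToEdge) :
    G.ReducibleToEdge := by
  have hmem : ∀ e' ∈ R, e' ∈ G.edges := fun e' he' => by simp [hG, he']
  refine of_step (.parallel G ⟨G.verts, R, fun e' he' => G.mem_verts e' (hmem e' he'),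
    fun e' he' => G.loopless e' (hmem e' he')⟩ e ?_ rfl (by simp [hG])) (h _ rfl rfl)
  have := Multiset.count_pos.2 he
  rw [hG, Multiset.count_cons_self]
  omega

theorem reducibleToEdge_of_doubleEdge {a b : V} (hab : a ≠ b) (hv : G.verts = {a, b})
    (he : G.edges = {s(a, b), s(a, b)}) : G.ReducibleToEdge :=
  .of_parallel he (by simp) fun H hv' he' => ⟨H, .refl, a, b, hab, hv'.trans hv, he'⟩

theorem reducibleToEdge_of_triangle {a b c : V} (hab : a ≠ b) (hac : a ≠ c) (hbc : b ≠ c)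
    (hv : G.verts = {a, b, c}) (he : G.edges = {s(a, b), s(a, c), s(b, c)}) :
    G.ReducibleToEdge := by
  refine .of_series (i := a) (j := c) (k := b) (R := {s(a, c)}) hac ?_
    (by simp [hab.symm, hbc]) fun H hv' he' => reducibleToEdge_of_doubleEdge hac ?_ he'
  · rw [he, Sym2.eq_swap (a := c), Multiset.pair_comm s(a, c)]
    rfl
  · rw [hv', hv]
    ext v
    simp only [Finset.mem_erase, Finset.mem_insert, Finset.mem_singleton]
    grind

theorem erase_image_range {p : ℕ → V} {m : ℕ} (hp : Set.InjOn p (Set.Iic (m + 1))) :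
    ((Finset.range (m + 2)).image p).erase (p (m + 1)) = (Finset.range (m + 1)).image p := by
  rw [Finset.range_add_one, Finset.image_insert, Finset.erase_insert]
  simp only [Finset.mem_image, Finset.mem_range, not_exists, not_and]
  intro i hi h
  have := hp (Set.mem_Iic.2 hi.le) (Set.mem_Iic.2 le_rfl) h
  omega

/-- A cycle `p 0, …, p m`, where a cycle of length two is a double edge. -/
theorem reducibleToEdge_of_cycle {p : ℕ → V} {m : ℕ} (hm : 1 ≤ m) (hp : Set.InjOn p (Set.Iic m))
    (hv : G.verts = (Finset.range (m + 1)).image p)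
    (he : G.edges = {s(p m, p 0)} + pathEdges p m) : G.ReducibleToEdge := by
  induction m, hm using Nat.le_induction generalizing G with
  | base =>
    have h01 : p 1 ≠ p 0 := fun h => by simpa using hp (by simp) (by simp) h
    refine reducibleToEdge_of_doubleEdge h01 ?_ ?_
    · rw [hv]; ext; simp [Finset.range_add_one]
    · rw [he, Sym2.eq_swap]; rfl
  | succ m hm ih =>
    have hm0 : p m ≠ p 0 := fun h => by
      have := hp (Set.mem_Iic.2 (by omega)) (Set.mem_Iic.2 (by omega)) h
      omega
    refine .of_series (i := p m) (j := p 0) (k := p (m + 1)) (R := pathEdges p m) hm0 ?_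
      (fun e he => notMem_of_mem_pathEdges hp he) fun H hv' he' =>
      ih (hp.mono (Set.Iic_subset_Iic.2 (by omega))) ?_ he'
    · rw [he, pathEdges, Multiset.range_succ, Multiset.map_cons, Sym2.eq_swap]
      simp only [pathEdges, Multiset.insert_eq_cons, Multiset.cons_add, Multiset.singleton_add]
      exact Multiset.cons_swap _ _ _
    · rw [hv', hv, erase_image_range hp]

/-- A wheel with at least two rim vertices, where the rim of length two is a double edge. -/
theorem reducibleToEdge_of_wheel {p : ℕ → V} {h : V} {m : ℕ} (hm : 1 ≤ m)
    (hp : Set.InjOn p (Set.Iic m)) (hh : ∀ i, p i ≠ h)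
    (hv : G.verts = insert h ((Finset.range (m + 1)).image p))
    (he : G.edges = {s(p m, p 0)} + (pathEdges p m + spokeEdges p h (m + 1))) :
    G.ReducibleToEdge := by
  induction m, hm using Nat.le_induction generalizing G with
  | base =>
    have h01 : p 0 ≠ p 1 := fun h => by simpa using hp (by simp) (by simp) h
    refine .of_parallel (e := s(p 0, p 1)) (R := pathEdges p 1 + spokeEdges p h 2) ?_
      (by simp [pathEdges]) fun H hv' he' =>
      reducibleToEdge_of_triangle h01 (hh 0) (hh 1) ?_ ?_
    · rw [he, Sym2.eq_swap]; rfl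
    · rw [hv', hv]; ext; simp [Finset.range_add_one]; tauto
    · rw [he']; rfl
  | succ m hm ih =>
    have hm0 : p m ≠ p 0 := fun h => by
      have := hp (Set.mem_Iic.2 (by omega)) (Set.mem_Iic.2 (by omega)) h
      omega
    refine .of_starTriangle (i := p m) (j := p 0) (l := h) (k := p (m + 1))
      (R := pathEdges p m + spokeEdges p h (m + 1)) hm0 (hh m) (hh 0) ?_ ?_ fun H hv₁ he₁ => ?_
    · have h1 : pathEdges p (m + 1) = s(p m, p (m + 1)) ::ₘ pathEdges p m := by
        simp [pathEdges, Multiset.range_succ]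
      have h2 : spokeEdges p h (m + 1 + 1) = s(h, p (m + 1)) ::ₘ spokeEdges p h (m + 1) := by
        rw [spokeEdges, Multiset.range_succ, Multiset.map_cons, Sym2.eq_swap, spokeEdges]
      rw [he, h1, h2, Sym2.eq_swap (a := p (m + 1))]
      simp only [Multiset.insert_eq_cons, ← Multiset.singleton_add]
      abel
    · intro e he
      rcases Multiset.mem_add.1 he with he | he
      · exact notMem_of_mem_pathEdges hp he
      · simp only [spokeEdges, Multiset.mem_map, Multiset.mem_range] at he
        obtain ⟨i, hi, rfl⟩ := he
        rw [Sym2.mem_iff]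
        rintro (h' | h')
        · have := hp (Set.mem_Iic.2 le_rfl) (Set.mem_Iic.2 hi.le) h'
          omega
        · exact hh _ h'
    -- the new edges at the hub are parallel to spokes
    have hspoke : ∀ i, i < m + 1 → s(p i, h) ∈ spokeEdges p h (m + 1) := fun i hi =>
      Multiset.mem_map.2 ⟨i, Multiset.mem_range.2 hi, rfl⟩
    refine .of_parallel (e := s(p 0, h))
      (R := s(p m, h) ::ₘ ({s(p m, p 0)} + (pathEdges p m + spokeEdges p h (m + 1)))) ?_
      (by simp [hspoke]) fun H₂ hv₂ he₂ => ?_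
    · rw [he₁]
      simp only [Multiset.insert_eq_cons, ← Multiset.singleton_add]
      abel
    refine .of_parallel he₂ (by simp [hspoke]) fun H₃ hv₃ he₃ =>
      ih (hp.mono (Set.Iic_subset_Iic.2 (by omega))) ?_ he₃
    rw [hv₃, hv₂, hv₁, hv, Finset.erase_insert_of_ne (hh _).symm, erase_image_range hp]

end Reductions

/-! ### The edges of cycles and wheels -/

theorem edges_ofSimple_eq {V : Type u} [Fintype V] {G : SimpleGraph V} {E : Multiset (Sym2 V)}
    (hE : E.Nodup) (h : ∀ e, e ∈ G.edgeSet ↔ e ∈ E) : (ofSimple G).edges = E :=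
  (Multiset.Nodup.ext (Finset.nodup _) hE).2 fun e => by simp [h]

theorem cycleGraph_adj_iff {m : ℕ} (hm : 1 ≤ m) (a b : Fin (m + 1)) :
    (SimpleGraph.cycleGraph (m + 1)).Adj a b ↔ (b : ℕ) = a + 1 ∨ (a : ℕ) = b + 1 ∨
      ((a : ℕ) = m ∧ (b : ℕ) = 0) ∨ ((b : ℕ) = m ∧ (a : ℕ) = 0) := by
  have key : ∀ c d : Fin (m + 1), (c - d).val = 1 ↔
      (c : ℕ) = d + 1 ∨ ((d : ℕ) = m ∧ (c : ℕ) = 0) := by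
    intro c d
    rw [Fin.val_sub]
    have hc := c.2
    have hd := d.2
    rcases lt_or_ge (c : ℕ) d with h | h
    · rw [Nat.mod_eq_of_lt (by omega)]
      omega
    · rw [show m + 1 - (d : ℕ) + c = (c - d) + (m + 1) by omega, Nat.add_mod_right,
        Nat.mod_eq_of_lt (by omega)]
      omega
  rw [SimpleGraph.cycleGraph_adj', key, key]
  tauto

theorem nodup_pathEdges {V : Type u} {p : ℕ → V} {m : ℕ} (hp : Set.InjOn p (Set.Iic m)) :
    (pathEdges p m).Nodup := by
  refine Multiset.Nodup.map_on ?_ (Multiset.nodup_range m)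
  intro i hi j hj hij
  rw [Multiset.mem_range] at hi hj
  rcases Sym2.eq_iff.1 hij with ⟨h, -⟩ | ⟨h, h'⟩
  · exact hp (Set.mem_Iic.2 hi.le) (Set.mem_Iic.2 hj.le) h
  · have h1 := hp (Set.mem_Iic.2 hi.le) (Set.mem_Iic.2 hj) h
    have h2 := hp (Set.mem_Iic.2 hi) (Set.mem_Iic.2 hj.le) h'
    omega

theorem closing_notMem_pathEdges {V : Type u} {p : ℕ → V} {m : ℕ} (hm : 2 ≤ m)
    (hp : Set.InjOn p (Set.Iic m)) : s(p m, p 0) ∉ pathEdges p m := by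
  simp only [pathEdges, Multiset.mem_map, Multiset.mem_range, not_exists, not_and]
  intro i hi h
  rcases Sym2.eq_iff.1 h with ⟨h, h'⟩ | ⟨h, h'⟩
  · have := hp (Set.mem_Iic.2 hi.le) (Set.mem_Iic.2 le_rfl) h
    omega
  · have h1 := hp (Set.mem_Iic.2 hi.le) (Set.mem_Iic.2 (by omega)) h
    have h2 := hp (Set.mem_Iic.2 hi) (Set.mem_Iic.2 le_rfl) h'
    omega

theorem injOn_ofNat (m : ℕ) : Set.InjOn (Fin.ofNat (m + 1)) (Set.Iic m) := by
  intro i hi j hj h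
  have := congrArg Fin.val h
  simp only [Fin.val_ofNat] at this
  rwa [Nat.mod_eq_of_lt (Nat.lt_succ_of_le hi), Nat.mod_eq_of_lt (Nat.lt_succ_of_le hj)] at this

theorem mem_edgeSet_cycleGraph_iff {m : ℕ} (hm : 1 ≤ m) (e : Sym2 (Fin (m + 1))) :
    e ∈ (SimpleGraph.cycleGraph (m + 1)).edgeSet ↔
      e = s(Fin.ofNat (m + 1) m, Fin.ofNat (m + 1) 0) ∨ e ∈ pathEdges (Fin.ofNat (m + 1)) m := by
  have hval : ∀ {i}, i ≤ m → (Fin.ofNat (m + 1) i : ℕ) = i := fun {i} hi => by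
    simp only [Fin.val_ofNat]
    exact Nat.mod_eq_of_lt (by omega)
  induction e using Sym2.ind with
  | _ a b =>
    rw [SimpleGraph.mem_edgeSet, cycleGraph_adj_iff hm]
    simp only [pathEdges, Multiset.mem_map, Multiset.mem_range, Sym2.eq_iff]
    simp only [Fin.ext_iff, hval le_rfl, hval (Nat.zero_le m)]
    constructor
    · rintro (h | h | ⟨h, h'⟩ | ⟨h, h'⟩)
      · refine Or.inr ⟨a, by omega, Or.inl ⟨hval (by omega), ?_⟩⟩
        rw [hval (by omega), h]
      · refine Or.inr ⟨b, by omega, Or.inr ⟨hval (by omega), ?_⟩⟩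
        rw [hval (by omega), h]
      · exact Or.inl (Or.inl ⟨h, h'⟩)
      · exact Or.inl (Or.inr ⟨h', h⟩)
    · rintro ((⟨h, h'⟩ | ⟨h, h'⟩) | ⟨i, hi, h⟩)
      · omega
      · omega
      · rw [hval hi.le, hval hi] at h
        omega

theorem image_range_ofNat (m : ℕ) :
    (Finset.range (m + 1)).image (Fin.ofNat (m + 1)) = Finset.univ := by
  ext a
  simp only [Finset.mem_image, Finset.mem_range, Finset.mem_univ, iff_true]
  exact ⟨a, a.2, Fin.ext (by simp)⟩

theorem reducibleToEdge_cycleGraph {n : ℕ} (hn : 3 ≤ n) :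
    (ofSimple (SimpleGraph.cycleGraph n)).ReducibleToEdge := by
  obtain ⟨m, rfl⟩ : ∃ m, n = m + 1 := ⟨n - 1, by omega⟩
  refine reducibleToEdge_of_cycle (p := Fin.ofNat (m + 1)) (by omega) (injOn_ofNat m)
    (image_range_ofNat m).symm (edges_ofSimple_eq ?_ fun e => ?_)
  · rw [Multiset.singleton_add, Multiset.nodup_cons]
    exact ⟨closing_notMem_pathEdges (by omega) (injOn_ofNat m), nodup_pathEdges (injOn_ofNat m)⟩
  · rw [mem_edgeSet_cycleGraph_iff (by omega), Multiset.singleton_add, Multiset.mem_cons]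

theorem mem_edgeSet_wheelGraph_iff {m : ℕ} (e : Sym2 (Option (Fin (m + 1)))) :
    e ∈ (wheelGraph (m + 2)).edgeSet ↔
      (∃ e' ∈ (SimpleGraph.cycleGraph (m + 1)).edgeSet, e'.map some = e) ∨
        e ∈ spokeEdges (fun i => some (Fin.ofNat (m + 1) i)) none (m + 1) := by
  have hspoke : ∀ a : Fin (m + 1),
      s(some a, none) ∈ spokeEdges (fun i => some (Fin.ofNat (m + 1) i)) none (m + 1) :=
    fun a => Multiset.mem_map.2 ⟨a, Multiset.mem_range.2 a.2, by simp⟩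
  have hrim : ∀ a b : Fin (m + 1),
      s(some a, some b) ∉ spokeEdges (fun i => some (Fin.ofNat (m + 1) i)) none (m + 1) := by
    intro a b h
    simp [spokeEdges] at h
  have hmap : ∀ e' : Sym2 (Fin (m + 1)), none ∉ e'.map some := fun e' => by simp
  induction e using Sym2.ind with
  | _ a b =>
    rw [SimpleGraph.mem_edgeSet]
    rcases a with _ | a <;> rcases b with _ | b
    · simp [wheelGraph, spokeEdges]
      intro e' _ h
      exact hmap e' (by simp [h])
    · exact iff_of_true trivial (Or.inr (by rw [Sym2.eq_swap]; exact hspoke b))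
    · exact iff_of_true trivial (Or.inr (hspoke a))
    · constructor
      · intro h
        exact Or.inl ⟨s(a, b), h, rfl⟩
      · rintro (⟨e', h, h'⟩ | h)
        · have : e' = s(a, b) := Sym2.map.injective (Option.some_injective _) h'
          subst this
          exact h
        · exact absurd h (hrim a b)

theorem nodup_rim_add_spokes {m : ℕ} {E : Multiset (Sym2 (Fin (m + 1)))} (hE : E.Nodup) :
    (E.map (Sym2.map some) +
      spokeEdges (fun i => some (Fin.ofNat (m + 1) i)) none (m + 1)).Nodup := by
  refine Multiset.Nodup.add_iff (hE.map (Sym2.map.injective (Option.some_injective _))) ?_ |>.2 ?_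
  · refine Multiset.Nodup.map_on ?_ (Multiset.nodup_range _)
    intro i hi j hj hij
    rw [Multiset.mem_range, Nat.lt_succ_iff] at hi hj
    exact injOn_ofNat m hi hj (by simpa using hij)
  · rw [Multiset.disjoint_left]
    intro e he he'
    obtain ⟨e', -, rfl⟩ := Multiset.mem_map.1 he
    obtain ⟨i, -, h⟩ := Multiset.mem_map.1 he'
    have : none ∉ e'.map (some : Fin (m + 1) → _) := by simp
    exact this (by rw [← h]; simp)

theorem reducibleToEdge_wheelGraph {n : ℕ} (hn : 3 ≤ n) :
    (ofSimple (wheelGraph n)).ReducibleToEdge := by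
  obtain ⟨m, rfl⟩ : ∃ m, n = m + 2 := ⟨n - 2, by omega⟩
  have hm : 1 ≤ m := by omega
  have hedges : ∀ E : Multiset (Sym2 (Fin (m + 1))), E.Nodup →
      (∀ e, e ∈ (SimpleGraph.cycleGraph (m + 1)).edgeSet ↔ e ∈ E) →
      (ofSimple (wheelGraph (m + 2))).edges = E.map (Sym2.map some) +
        spokeEdges (fun i => some (Fin.ofNat (m + 1) i)) none (m + 1) := fun E hE h =>
    edges_ofSimple_eq (nodup_rim_add_spokes hE) fun e => by
      rw [mem_edgeSet_wheelGraph_iff, Multiset.mem_add, Multiset.mem_map]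
      simp only [h]
  rcases hm.eq_or_lt with rfl | hm2
  -- the rim of the wheel on three vertices is a single edge, not a double one
  · refine reducibleToEdge_of_triangle (a := some 0) (b := some 1) (c := none) (by simp) (by simp)
      (by simp) (by ext v; revert v; decide) ((hedges {s(0, 1)} (by simp) ?_).trans ?_)
    · intro e
      rw [mem_edgeSet_cycleGraph_iff le_rfl]
      revert e
      decide
    · rfl
  · refine reducibleToEdge_of_wheel (p := fun i => some (Fin.ofNat (m + 1) i)) (h := none) hm
      ((Option.some_injective _).comp_injOn (injOn_ofNat m)) (by simp) ?_
      ((hedges ({s(Fin.ofNat (m + 1) m, Fin.ofNat (m + 1) 0)} + pathEdges (Fin.ofNat (m + 1)) m)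
        ?_ fun e => ?_).trans ?_)
    · ext v
      rcases v with _ | a
      · simp [ofSimple]
      · have := image_range_ofNat m ▸ Finset.mem_univ a
        simpa [ofSimple] using this
    · rw [Multiset.singleton_add, Multiset.nodup_cons]
      exact ⟨closing_notMem_pathEdges (by omega) (injOn_ofNat m), nodup_pathEdges (injOn_ofNat m)⟩
    · rw [mem_edgeSet_cycleGraph_iff hm, Multiset.singleton_add, Multiset.mem_cons]
    · simp [pathEdges, Multiset.map_map, Function.comp_def]

/-- The hub and the rim minus one edge form a cycle through all vertices of the wheel. -/
theorem cycleGraph_isContained_wheelGraph {n : ℕ} (hn : 3 ≤ n) :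
    (SimpleGraph.cycleGraph n).IsContained (wheelGraph n) := by
  obtain ⟨m, rfl⟩ : ∃ m, n = m + 2 := ⟨n - 2, by omega⟩
  refine ⟨⟨⟨fun i : Fin (m + 2) => Fin.cases none some i, ?_⟩, ?_⟩⟩
  · intro a b hab
    rw [cycleGraph_adj_iff (by omega)] at hab
    induction a using Fin.cases with
    | zero =>
      induction b using Fin.cases with
      | zero => simp at hab
      | succ b => trivial
    | succ a =>
      induction b using Fin.cases with
      | zero => trivial
      | succ b =>
        refine (cycleGraph_adj_iff (by omega) a b).2 ?_
        simp only [Fin.val_succ] at hab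
        omega
  · intro a b hab
    induction a using Fin.cases <;> induction b using Fin.cases <;> simp_all

end LooplessMultigraph

theorem mainTheorem6 :
    (∀ (V : Type u) [Fintype V] [DecidableEq V] (G : LooplessMultigraph V),
      G.verts = Finset.univ → G.ReducibleToEdge →
        ∀ α : EdgeWeights V, α.SupportedOn G → α.AldousHolds) ∧
    (∀ n : ℕ, 3 ≤ n →
      (LooplessMultigraph.ofSimple (wheelGraph n)).ReducibleToEdge ∧
      ∀ α : EdgeWeights (Option (Fin (n - 1))),
        α.SupportedOn (LooplessMultigraph.ofSimple (wheelGraph n)) → α.AldousHolds) ∧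
    (∀ n : ℕ, 3 ≤ n →
      (SimpleGraph.cycleGraph n).IsContained (wheelGraph n) ∧
      (LooplessMultigraph.ofSimple (SimpleGraph.cycleGraph n)).ReducibleToEdge ∧
      ∀ α : EdgeWeights (Fin n),
        α.SupportedOn (LooplessMultigraph.ofSimple (SimpleGraph.cycleGraph n)) →
          α.AldousHolds) := by
  refine ⟨fun V _ _ G hverts hG α hα => hG.aldousHolds hverts hα, fun n hn => ?_, fun n hn => ?_⟩
  · have h := LooplessMultigraph.reducibleToEdge_wheelGraph hn
    exact ⟨h, fun α hα => h.aldousHolds rfl hα⟩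
  · have h := LooplessMultigraph.reducibleToEdge_cycleGraph hn
    exact ⟨LooplessMultigraph.cycleGraph_isContained_wheelGraph hn, h,
      fun α hα => h.aldousHolds rfl hα⟩
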